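/- Let $n\ge 1$, $\hbar\in\mathbb{R}\setminus\{0\}$, $\lambda,\mu\in\mathbb{C}$, $\delta=\mu-\lambda$, and assume $\delta\neq 1+\frac{\ell}{n+1}$ for all $\ell=0,1,2,\dots$. Work in an affine chart $\mathbb{R}^n$ of $S^n$ with coordinates $x^i$ (summation over repeated indices is understood), in which $\mathrm{sl}(n+1,\mathbb{R})$ is spanned by the vector fields $\partial_i$, $x^i\partial_j$, $x^ix^j\partial_j$. Let $\mathcal{S}_\delta=\bigoplus_k\mathcal{S}_{k,\delta}$ be the space of symbols, i.e. of polynomials in $\xi_1,\dots,\xi_n$ with coefficients in $C^\infty(\mathbb{R}^n,\mathbb{C})$, graded by the degree in $\xi$, on which a vector field $X$ acts by $L_XP=X^i\frac{\partial P}{\partial x^i}-\frac{\partial X^i}{\partial x^j}\,\xi_i\frac{\partial P}{\partial\xi_j}+\delta\,(\partial_iX^i)P$. Let $\mathcal{D}_{\lambda,\mu}$ be the space of linear differential operators with smooth coefficients from $\lambda$-densities to $\mu$-densities, on which $X$ acts by $A\mapsto L_X^\mu A-AL_X^\lambda$, where $L_X^\lambda\phi=X^i\partial_i\phi+\lambda(\partial_iX^i)\phi$.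 Identify $\mathcal{S}_\delta$ with $\mathcal{D}_{\lambda,\mu}$ by normal ordering $$\mathcal{I}:\;P^{i_1\ldots i_k}(x)\,\xi_{i_1}\cdots\xi_{i_k}\longmapsto(-i\hbar)^kP^{i_1\ldots i_k}(x)\,\partial_{i_1}\cdots\partial_{i_k},$$ and put $\mathcal{E}=\xi_i\frac{\partial}{\partial\xi_i}$, $\mathrm{D}=\frac{\partial}{\partial x^i}\frac{\partial}{\partial\xi_i}$ on $\mathcal{S}_\delta$. A projectively equivariant quantization map is a $\mathbb{C}$-linear map $\mathcal{Q}:\mathcal{S}_\delta\to\mathcal{D}_{\lambda,\mu}$ that commutes with the action of $\mathrm{sl}(n+1,\mathbb{R})$ and preserves the principal symbol: for $P\in\mathcal{S}_{k,\delta}$, the operator $\mathcal{Q}(P)-\mathcal{I}(P)$ has order less than $k$. Then there is exactly one projectively equivariant quantization map $\mathcal{Q}_{\lambda,\mu}$, and, under the identification $\mathcal{I}$, it is given by the series $$\mathcal{Q}_{\lambda,\mu}=\sum_{m\ge0}C_m(\mathcal{E})\,(-i\hbar\mathrm{D})^m,\qquad C_m(\mathcal{E})=\frac{1}{m!}\,\frac{(\mathcal{E}+(n+1)\lambda)_m}{(2\mathcal{E}+(n+1)(1-\delta)+m-1)_m},$$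 with $(a)_m=a(a+1)\cdots(a+m-1)$; the denominators are invertible operators on $\mathcal{S}_\delta$, and on symbols of degree at most $k$ only the terms $m=0,\dots,k$ contribute, i.e. $\mathcal{Q}_{\lambda,\mu}(P)=\mathcal{I}\bigl(\sum_{m=0}^{k}C_m(\mathcal{E})(-i\hbar\mathrm{D})^mP\bigr)$. -/

import Mathlib

open scoped ContDiff

noncomputable section

namespace ProjQuant

/-- Smooth complex-valued functions on the affine chart `ℝⁿ`, as a subalgebra of all functions. -/
def smoothSubalgebra (n : ℕ) : Subalgebra ℂ ((Fin n → ℝ) → ℂ) where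
  carrier := {f | ContDiff ℝ ∞ f}
  mul_mem' hf hg := by
    rw [Set.mem_ofPred_eq] at *
    exact hf.mul hg
  add_mem' hf hg := by
    rw [Set.mem_ofPred_eq] at *
    exact hf.add hg
  algebraMap_mem' c := by
    rw [Set.mem_ofPred_eq]
    exact contDiff_const (c := c)

/-- The algebra of smooth complex-valued functions on the affine chart `ℝⁿ`.  Its elements are the
coordinate expressions of tensor densities of any degree, and the coefficients of symbols and of
differential operators. -/
def Smooth (n : ℕ) : Type := smoothSubalgebra n

instance (n : ℕ) : CommRing (Smooth n) := inferInstanceAs (CommRing (smoothSubalgebra n))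

instance (n : ℕ) : Algebra ℂ (Smooth n) := inferInstanceAs (Algebra ℂ (smoothSubalgebra n))

instance (n : ℕ) : CoeFun (Smooth n) (fun _ => (Fin n → ℝ) → ℂ) := ⟨fun f => f.1⟩

theorem Smooth.contDiff {n : ℕ} (f : Smooth n) : ContDiff ℝ ∞ f := f.2

/-- The `i`-th affine coordinate function `xⁱ`. -/
def coord {n : ℕ} (i : Fin n) : Smooth n :=
  ⟨fun x => ((x i : ℝ) : ℂ),
    show ContDiff ℝ ∞ _ from Complex.ofRealCLM.contDiff.comp (contDiff_apply ℝ ℝ i)⟩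

/-- The partial derivative `∂/∂xⁱ` on smooth functions. -/
def pd {n : ℕ} (i : Fin n) : Module.End ℂ (Smooth n) where
  toFun f := ⟨fun x => fderiv ℝ f x (Pi.single i 1),
    (f.contDiff.fderiv_right (m := ∞) (by simp)).clm_apply contDiff_const⟩
  map_add' f g := by
    refine Subtype.ext (funext fun x => ?_)
    have hf := f.contDiff.differentiable (by simp) x
    have hg := g.contDiff.differentiable (by simp) x
    exact congrArg (fun L => L (Pi.single i 1)) (fderiv_add hf hg)
  map_smul' c f := by
    refine Subtype.ext (funext fun x => ?_)
    have hf := f.contDiff.differentiable (by simp) x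
    exact congrArg (fun L => L (Pi.single i 1)) (fderiv_const_smul hf c)

/-- Symbols: polynomials in the fibre coordinates `ξ₁, …, ξₙ` of `T*ℝⁿ` whose coefficients are
smooth functions of `x`. -/
abbrev Symbol (n : ℕ) : Type := MvPolynomial (Fin n) (Smooth n)

/-- The linear map on symbols with `a ξ^s ↦ g s a`. -/
def Symbol.lift {n : ℕ} {M : Type} [AddCommMonoid M] [Module ℂ M]
    (g : (Fin n →₀ ℕ) → Smooth n →ₗ[ℂ] M) : Symbol n →ₗ[ℂ] M :=
  Finsupp.lsum ℂ g ∘ₗ (AddMonoidAlgebra.coeffLinearEquiv ℂ).toLinearMap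

theorem Symbol.lift_monomial {n : ℕ} {M : Type} [AddCommMonoid M] [Module ℂ M]
    (g : (Fin n →₀ ℕ) → Smooth n →ₗ[ℂ] M) (s : Fin n →₀ ℕ) (a : Smooth n) :
    Symbol.lift g (MvPolynomial.monomial s a) = g s a :=
  MvPolynomial.sum_monomial_eq (map_zero _)

/-- `∂/∂xⁱ` on symbols (it acts on the coefficients). -/
def dx {n : ℕ} (i : Fin n) : Module.End ℂ (Symbol n) :=
  Symbol.lift fun s => (MvPolynomial.monomial s).restrictScalars ℂ ∘ₗ pd i

/-- `∂/∂ξᵢ` on symbols. -/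
def dxi {n : ℕ} (i : Fin n) : Module.End ℂ (Symbol n) :=
  (MvPolynomial.pderiv i).toLinearMap.restrictScalars ℂ

/-- Multiplication of symbols by a fixed symbol. -/
def mulSym {n : ℕ} (P : Symbol n) : Module.End ℂ (Symbol n) := LinearMap.mulLeft ℂ P

/-- The Euler operator `ξᵢ ∂/∂ξᵢ`. -/
def euler (n : ℕ) : Module.End ℂ (Symbol n) := ∑ i, mulSym (MvPolynomial.X i) * dxi i

/-- The divergence operator `∂/∂xⁱ ∂/∂ξᵢ`. -/
def divergence (n : ℕ) : Module.End ℂ (Symbol n) := ∑ i, dx i * dxi i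

/-- The iterated partial derivative `∂^s` for a multi-index `s`. -/
def multiPd {n : ℕ} (s : Fin n →₀ ℕ) : Module.End ℂ (Smooth n) :=
  (List.ofFn fun i => pd i ^ s i).prod

/-- Multiplication of functions by a fixed function. -/
def mulFun {n : ℕ} (a : Smooth n) : Module.End ℂ (Smooth n) := LinearMap.mulLeft ℂ a

/-- Differential operators of order `< k` with smooth coefficients on `ℝⁿ`. -/
def diffOpLT (n k : ℕ) : Submodule ℂ (Module.End ℂ (Smooth n)) :=
  Submodule.span ℂ {A | ∃ (a : Smooth n) (s : Fin n →₀ ℕ), s.degree < k ∧ A = mulFun a * multiPd s}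

/-- Differential operators (of finite order, with smooth coefficients) on `ℝⁿ`. -/
def diffOp (n : ℕ) : Submodule ℂ (Module.End ℂ (Smooth n)) := ⨆ k, diffOpLT n k

/-- Normal ordering: `a ξ^s ↦ (-iħ)^|s| a ∂^s`. -/
def normalOrder (n : ℕ) (ħ : ℝ) : Symbol n →ₗ[ℂ] Module.End ℂ (Smooth n) :=
  Symbol.lift fun s => (-Complex.I * ħ) ^ s.degree •
    (LinearMap.mulRight ℂ (multiPd s) ∘ₗ LinearMap.mul ℂ (Smooth n))

/-- Vector fields, given by their components. -/
abbrev VField (n : ℕ) : Type := Fin n → Smooth n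

/-- The Lie algebra `sl(n+1, ℝ)` of projective vector fields in affine coordinates: the real span of
`∂/∂xⁱ`, `xⁱ ∂/∂xʲ` and `xⁱ xʲ ∂/∂xʲ` (summed over `j`). -/
def projectiveFields (n : ℕ) : Submodule ℝ (VField n) :=
  Submodule.span ℝ
    (Set.range (fun i : Fin n => (Pi.single i 1 : VField n)) ∪
     Set.range (fun p : Fin n × Fin n => (Pi.single p.2 (coord p.1) : VField n)) ∪
     Set.range (fun i : Fin n => (fun j => coord i * coord j : VField n)))

/-- The divergence `∂ᵢXⁱ` of a vector field. -/
def VField.div {n : ℕ} (X : VField n) : Smooth n := ∑ i, pd i (X i)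

/-- The Lie derivative of densities of degree `lam`:
`L_X φ = Xⁱ ∂ᵢφ + lam (∂ᵢXⁱ) φ`. -/
def lieDensity {n : ℕ} (lam : ℂ) (X : VField n) : Module.End ℂ (Smooth n) :=
  ∑ i, mulFun (X i) * pd i + lam • mulFun X.div

/-- The Lie derivative of operators from densities of degree `lam` to densities of degree `mu`. -/
def lieOp {n : ℕ} (lam mu : ℂ) (X : VField n) (A : Module.End ℂ (Smooth n)) :
    Module.End ℂ (Smooth n) :=
  lieDensity mu X * A - A * lieDensity lam X

/-- The Lie derivative of symbols with values in densities of degree `δ`: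
`L_X P = Xⁱ ∂P/∂xⁱ - (∂Xⁱ/∂xʲ) ξᵢ ∂P/∂ξⱼ + δ (∂ᵢXⁱ) P`. -/
def lieSymbol {n : ℕ} (δ : ℂ) (X : VField n) : Module.End ℂ (Symbol n) :=
  ∑ i, mulSym (MvPolynomial.C (X i)) * dx i
    - ∑ i, ∑ j, mulSym (MvPolynomial.C (pd j (X i)) * MvPolynomial.X i) * dxi j
    + δ • mulSym (MvPolynomial.C X.div)

/-- `Q` is a projectively equivariant quantization map (from symbols of weight `mu - lam` to
differential operators from `lam`-densities to `mu`-densities): it intertwines the actions of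
`sl(n+1, ℝ)`, and a symbol `P` that is homogeneous of degree `k` is the principal symbol of `Q P`
(the momentum `ξᵢ` corresponding to `-iħ ∂/∂xⁱ`). -/
structure IsQuantization (n : ℕ) (ħ : ℝ) (lam mu : ℂ)
    (Q : Symbol n →ₗ[ℂ] Module.End ℂ (Smooth n)) : Prop where
  mem_diffOp : ∀ P, Q P ∈ diffOp n
  principal : ∀ (k : ℕ) (P : Symbol n), P.IsHomogeneous k → Q P - normalOrder n ħ P ∈ diffOpLT n k
  equivariant : ∀ X ∈ projectiveFields n, ∀ P, Q (lieSymbol (mu - lam) X P) = lieOp lam mu X (Q P)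

/-- The Pochhammer symbol `(A)_m = A (A + 1) ⋯ (A + m - 1)` of an operator `A`. -/
def opPochhammer {n : ℕ} (A : Module.End ℂ (Symbol n)) (m : ℕ) : Module.End ℂ (Symbol n) :=
  Polynomial.aeval A (ascPochhammer ℂ m)

/-- The numerator `(E + (n+1) lam)_m`. -/
def coeffNum (n : ℕ) (lam : ℂ) (m : ℕ) : Module.End ℂ (Symbol n) :=
  opPochhammer (euler n + algebraMap ℂ _ ((n + 1) * lam)) m

/-- The denominator `(2E + (n+1)(1-δ) + m - 1)_m`. -/
def coeffDen (n : ℕ) (δ : ℂ) (m : ℕ) : Module.End ℂ (Symbol n) :=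
  opPochhammer ((2 : ℂ) • euler n + algebraMap ℂ _ ((n + 1) * (1 - δ) + m - 1)) m

/-- The operator `C_m(E) = (1/m!) (E + (n+1) lam)_m / (2E + (n+1)(1-δ) + m - 1)_m`, where
`δ = mu - lam`. (`Ring.inverse` is the inverse of an invertible operator.) -/
def coeffOp (n : ℕ) (lam mu : ℂ) (m : ℕ) : Module.End ℂ (Symbol n) :=
  (1 / (m.factorial : ℂ)) • (coeffNum n lam m * Ring.inverse (coeffDen n (mu - lam) m))

end ProjQuant

end

noncomputable section

namespace ProjQuant

open MvPolynomial hiding funext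

/-! ### Partial derivatives, symbols, and functions of the Euler operator. -/

section

variable {n : ℕ}

/-! Write θ = -iħ, E for the Euler operator, D for the divergence. All that existence needs from a
projective field X is the shape of its second derivatives, ∂ⱼ∂ₖXⁱ = αⱼδᵢₖ + αₖδᵢⱼ with α constant
(`HasProjHessian`); put T = αⱼ∂/∂ξⱼ.

Existence. Pulled back through normal ordering, the action on operators is L_X - θ(E + (n+1)λ)T
(`lieOp_normalOrder`), while D fails to commute with L_X by (2E + (n+1)(1-δ))T
(`divergence_lieSymbol`). Since D f(E) = f(E+1) D, the defect of D^(m+1) is (m+1)(2E + m +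
(n+1)(1-δ)) T D^m. So Σ C_m(E)(θD)^m intertwines the two actions as soon as C_{m+1}(k)·(m+1)(2k + m
+ (n+1)(1-δ)) = (k + (n+1)λ)·C_m(k+1), and the stated coefficients satisfy this (`coeffValue_succ`).
The sum telescopes; its remainder contains T D^N, which kills symbols of degree at most N.

Uniqueness. A quadratic Casimir expression in the action is the scalar `casimirValue` on symbols of
degree k (`casimir_lieSymbol`), so any quantization sends them into that eigenspace of the same
expression on operators. The condition on δ makes these scalars pairwise distinct
(`casimirValue_ne`). Operators of order below k lie in the sum of the eigenspaces of lower degrees,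
and two quantizations of a symbol of degree k differ by such an operator which is also in the k-th
eigenspace; independence of eigenspaces makes it zero.

Functions of E are handled through the algebra map `eulerFun` from sequences, so identities between
them are checked degree by degree. -/

theorem Smooth.differentiable (f : Smooth n) : Differentiable ℝ (f : (Fin n → ℝ) → ℂ) :=
  f.contDiff.differentiable (by simp)

theorem pd_mul (i : Fin n) (f g : Smooth n) : pd i (f * g) = f * pd i g + g * pd i f := by
  refine Subtype.ext (funext fun x => ?_)
  exact congrArg (fun L => L (Pi.single i 1)) (fderiv_mul (f.differentiable x) (g.differentiable x))

theorem pd_one (i : Fin n) : pd i (1 : Smooth n) = 0 := by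
  have h := pd_mul i (1 : Smooth n) 1
  simpa using h

theorem pd_algebraMap (i : Fin n) (c : ℂ) : pd i (algebraMap ℂ (Smooth n) c) = 0 := by
  rw [Algebra.algebraMap_eq_smul_one, map_smul, pd_one, smul_zero]

theorem pd_coord (i j : Fin n) : pd i (coord j) = if i = j then (1 : Smooth n) else 0 := by
  refine Subtype.ext (funext fun x => ?_)
  have h : HasFDerivAt (fun x : Fin n → ℝ => ((x j : ℝ) : ℂ))
      (Complex.ofRealCLM.comp (ContinuousLinearMap.proj j)) x :=
    (Complex.ofRealCLM.comp (ContinuousLinearMap.proj (R := ℝ) (φ := fun _ : Fin n => ℝ) j)).hasFDerivAt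
  have h2 : (pd i (coord j)).1 x = if i = j then 1 else 0 := by
    change fderiv ℝ (fun x : Fin n → ℝ => ((x j : ℝ) : ℂ)) x (Pi.single i 1) = _
    rw [h.fderiv]
    by_cases hij : i = j
    · subst hij; simp
    · simp [hij, Ne.symm hij]
  rw [h2]
  split_ifs <;> rfl

theorem pd_comm (i j : Fin n) (f : Smooth n) : pd i (pd j f) = pd j (pd i f) := by
  refine Subtype.ext (funext fun x => ?_)
  have key (v w : Fin n → ℝ) : fderiv ℝ (fun y => fderiv ℝ f y v) x w
      = fderiv ℝ (fderiv ℝ f) x w v := by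
    have hd : DifferentiableAt ℝ (fderiv ℝ (f : (Fin n → ℝ) → ℂ)) x :=
      (f.contDiff.fderiv_right (m := ∞) (by simp)).differentiable (by simp) x
    rw [fderiv_clm_apply hd (differentiableAt_const v)]
    simp
  have hs := (f.contDiff.contDiffAt (x := x)).isSymmSndFDerivAt
    (by simpa using (WithTop.coe_le_coe.mpr (le_top : (2 : ℕ∞) ≤ ⊤)))
  exact (key _ _).trans ((hs.eq _ _).trans (key _ _).symm)

theorem pd_mul_pd (i j : Fin n) : pd i * pd j = pd j * pd i :=
  LinearMap.ext (pd_comm i j)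

theorem Symbol.hom_ext {M : Type*} [AddCommMonoid M] [Module ℂ M] {f g : Symbol n →ₗ[ℂ] M}
    (h : ∀ s a, f (monomial s a) = g (monomial s a)) : f = g := by
  refine LinearMap.ext fun P => ?_
  rw [P.as_sum, map_sum, map_sum]
  exact Finset.sum_congr rfl fun s _ => h s _

@[simp] theorem mulSym_apply (P Q : Symbol n) : mulSym P Q = P * Q := rfl

@[simp] theorem mulFun_apply (a b : Smooth n) : mulFun a b = a * b := rfl

theorem dx_monomial (i : Fin n) (s : Fin n →₀ ℕ) (a : Smooth n) :
    dx i (monomial s a) = monomial s (pd i a) := Symbol.lift_monomial _ s a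

theorem dxi_apply (i : Fin n) (P : Symbol n) : dxi i P = pderiv i P := rfl

theorem dx_C_mul (i : Fin n) (a : Smooth n) (P : Symbol n) :
    dx i (C a * P) = C (pd i a) * P + C a * dx i P := by
  have h : dx i * mulSym (C a) = mulSym (C (pd i a)) + mulSym (C a) * dx i := by
    refine Symbol.hom_ext fun s b => ?_
    simp only [Module.End.mul_apply, LinearMap.add_apply, mulSym_apply, C_mul_monomial, dx_monomial,
      pd_mul, map_add]
    rw [add_comm, mul_comm b]
  exact LinearMap.congr_fun h P

theorem dx_X_mul (i j : Fin n) (P : Symbol n) : dx i (X j * P) = X j * dx i P := by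
  have h : dx i * mulSym (X j) = mulSym (X j) * dx i := by
    refine Symbol.hom_ext fun s b => ?_
    simp only [Module.End.mul_apply, mulSym_apply, dx_monomial, X, monomial_mul, one_mul]
  exact LinearMap.congr_fun h P

theorem dx_comm (i j : Fin n) (P : Symbol n) : dx i (dx j P) = dx j (dx i P) := by
  have h : dx i * dx j = dx j * dx (n := n) i := by
    refine Symbol.hom_ext fun s b => ?_
    simp only [Module.End.mul_apply, dx_monomial, pd_comm i j]
  exact LinearMap.congr_fun h P

theorem dx_dxi (i j : Fin n) (P : Symbol n) : dx i (dxi j P) = dxi j (dx i P) := by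
  have h : dx i * dxi j = dxi j * dx (n := n) i := by
    refine Symbol.hom_ext fun s b => ?_
    simp only [Module.End.mul_apply, dx_monomial, dxi_apply, pderiv_monomial, pd_mul]
    congr 1
    rw [← map_natCast (algebraMap ℂ (Smooth n)), pd_algebraMap]
    ring
  exact LinearMap.congr_fun h P

theorem dxi_C_mul (i : Fin n) (a : Smooth n) (P : Symbol n) :
    dxi i (C a * P) = C a * dxi i P := by
  simp [dxi_apply]

theorem dxi_X_mul (i j : Fin n) (P : Symbol n) :
    dxi i (X j * P) = (if i = j then P else 0) + X j * dxi i P := by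
  rw [dxi_apply, pderiv_mul, pderiv_X, dxi_apply]
  by_cases h : i = j
  · subst h; simp
  · simp [h, Ne.symm h]

theorem dxi_comm (i j : Fin n) (P : Symbol n) : dxi i (dxi j P) = dxi j (dxi i P) := by
  simp only [dxi_apply]
  have h : ⁅pderiv (R := Smooth n) i, pderiv (R := Smooth n) j⁆ = 0 := by
    ext k
    simp [Derivation.commutator_apply, pderiv_X, Pi.single_apply, apply_ite (pderiv _)]
  have := DFunLike.congr_fun h P
  rw [Derivation.commutator_apply] at this
  exact sub_eq_zero.mp this

/-- The function `f` of the Euler operator: multiplication by `f k` in degree `k`. -/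
def eulerFun (n : ℕ) : (ℕ → ℂ) →ₐ[ℂ] Module.End ℂ (Symbol n) :=
  AlgHom.ofLinearMap
    { toFun := fun f => Symbol.lift fun s => f s.degree • (monomial s).restrictScalars ℂ
      map_add' := fun f g => Symbol.hom_ext fun s a => by
        simp [Symbol.lift_monomial, add_smul]
      map_smul' := fun c f => Symbol.hom_ext fun s a => by
        simp [Symbol.lift_monomial, mul_smul] }
    (Symbol.hom_ext fun s a => by simp [Symbol.lift_monomial])
    (fun f g => Symbol.hom_ext fun s a => by
      simp only [LinearMap.coe_mk, AddHom.coe_mk, Module.End.mul_apply, Symbol.lift_monomial,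
        LinearMap.smul_apply, LinearMap.restrictScalars_apply, map_smul, Pi.mul_apply, smul_smul]
      rw [mul_comm])

theorem eulerFun_monomial (f : ℕ → ℂ) (s : Fin n →₀ ℕ) (a : Smooth n) :
    eulerFun n f (monomial s a) = f s.degree • monomial s a := Symbol.lift_monomial _ s a

theorem euler_eq : euler n = eulerFun n (fun k => (k : ℂ)) := by
  refine Symbol.hom_ext fun s a => ?_
  rw [eulerFun_monomial, euler, LinearMap.sum_apply]
  simp only [Module.End.mul_apply, mulSym_apply, dxi_apply, X_mul_pderiv_monomial]
  rw [← Finset.sum_smul, Finsupp.degree_eq_sum, Nat.cast_smul_eq_nsmul]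

theorem dx_eulerFun (i : Fin n) (f : ℕ → ℂ) : dx i * eulerFun n f = eulerFun n f * dx i := by
  refine Symbol.hom_ext fun s a => ?_
  simp only [Module.End.mul_apply, dx_monomial, eulerFun_monomial, map_smul]

theorem mulSym_C_eulerFun (a : Smooth n) (f : ℕ → ℂ) :
    mulSym (C a) * eulerFun n f = eulerFun n f * mulSym (C a) := by
  refine Symbol.hom_ext fun s b => ?_
  simp only [Module.End.mul_apply, mulSym_apply, C_mul_monomial, eulerFun_monomial, mul_smul_comm]

theorem mulSym_X_eulerFun (i : Fin n) (f : ℕ → ℂ) :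
    mulSym (X i) * eulerFun n (fun k => f (k + 1)) = eulerFun n f * mulSym (X i) := by
  refine Symbol.hom_ext fun s b => ?_
  simp only [Module.End.mul_apply, mulSym_apply, X, monomial_mul, eulerFun_monomial, mul_smul_comm,
    map_add, Finsupp.degree_single, add_comm 1]

theorem dxi_eulerFun (i : Fin n) (f : ℕ → ℂ) :
    dxi i * eulerFun n f = eulerFun n (fun k => f (k + 1)) * dxi i := by
  refine Symbol.hom_ext fun s a => ?_
  simp only [Module.End.mul_apply, eulerFun_monomial, map_smul, dxi_apply, pderiv_monomial]
  -- Subtraction of exponents is truncated; when `s i = 0` the coefficient `s i` kills both sides,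
  -- otherwise the degree really drops by one.
  by_cases h : s i = 0
  · simp [h]
  · congr 2
    have hs : (s - Finsupp.single i 1) + Finsupp.single i 1 = s :=
      tsub_add_cancel_of_le (Finsupp.single_le_iff.mpr (Nat.one_le_iff_ne_zero.mpr h))
    conv_lhs => rw [← hs]
    simp

theorem eulerFun_congr {N : ℕ} {P : Symbol n} (hP : P.totalDegree ≤ N) {f g : ℕ → ℂ}
    (h : ∀ k ≤ N, f k = g k) : eulerFun n f P = eulerFun n g P := by
  rw [P.as_sum, map_sum, map_sum]
  refine Finset.sum_congr rfl fun s hs => ?_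
  rw [eulerFun_monomial, eulerFun_monomial, h]
  exact (le_totalDegree hs).trans hP

theorem eulerFun_of_isHomogeneous {k : ℕ} {P : Symbol n} (hP : P.IsHomogeneous k) (f : ℕ → ℂ) :
    eulerFun n f P = f k • P := by
  conv_lhs => rw [P.as_sum, map_sum]
  conv_rhs => rw [P.as_sum, Finset.smul_sum]
  refine Finset.sum_congr rfl fun s hs => ?_
  have h : s.degree = k := by
    rw [Finsupp.degree_eq_weight_one]
    exact hP (mem_support_iff.mp hs)
  rw [eulerFun_monomial, h]

end

/-! ### Normal ordering and composition with multiplication operators. -/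

section

variable {n : ℕ}

theorem normalOrder_monomial (ħ : ℝ) (s : Fin n →₀ ℕ) (a : Smooth n) :
    normalOrder n ħ (monomial s a)
      = (-Complex.I * ħ) ^ s.degree • (mulFun a * multiPd s) :=
  Symbol.lift_monomial _ s a

theorem multiPd_zero : multiPd (0 : Fin n →₀ ℕ) = 1 := by
  simp [multiPd]

/-- `multiPd` is an ordered product, so the extra factor must be commuted to the right end; `Nodup`
ensures that it appears only once. -/
theorem prod_map_pd_pow_add_single (s : Fin n →₀ ℕ) (i : Fin n) (l : List (Fin n)) (hl : l.Nodup) :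
    (l.map fun j => pd j ^ (s + Finsupp.single i 1 : Fin n →₀ ℕ) j).prod
      = (l.map fun j => pd j ^ s j).prod * if i ∈ l then pd i else 1 := by
  induction l with
  | nil => simp
  | cons a t ih =>
    rw [List.nodup_cons] at hl
    rw [List.map_cons, List.map_cons, List.prod_cons, List.prod_cons, ih hl.2]
    by_cases hai : a = i
    · subst hai
      have hc : Commute (pd a) (t.map fun j => pd j ^ s j).prod :=
        Commute.list_prod_right _ _ fun x hx => by
          obtain ⟨j, -, rfl⟩ := List.mem_map.mp hx
          exact (show Commute (pd a) (pd j) from pd_mul_pd a j).pow_right _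
      simp only [hl.1, if_false, mul_one, Finsupp.add_apply, Finsupp.single_eq_same, pow_succ,
        List.mem_cons, true_or, if_true, mul_assoc, hc.eq]
    · simp [hai, Ne.symm hai, mul_assoc]

theorem multiPd_add_single (s : Fin n →₀ ℕ) (i : Fin n) :
    multiPd (s + Finsupp.single i 1) = multiPd s * pd i := by
  simpa [multiPd, List.ofFn_eq_map] using
    prod_map_pd_pow_add_single s i (List.finRange n) (List.nodup_finRange n)

theorem normalOrder_C_mul (ħ : ℝ) (a : Smooth n) (P : Symbol n) :
    normalOrder n ħ (C a * P) = mulFun a * normalOrder n ħ P := by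
  have h : normalOrder n ħ ∘ₗ mulSym (C a)
      = LinearMap.mulLeft ℂ (mulFun a) ∘ₗ normalOrder n ħ := by
    refine Symbol.hom_ext fun s b => ?_
    simp only [LinearMap.comp_apply, mulSym_apply, C_mul_monomial, normalOrder_monomial,
      LinearMap.mulLeft_apply, mul_smul_comm, ← mul_assoc]
    congr 2
    exact LinearMap.ext fun f => mul_assoc a b f
  exact LinearMap.congr_fun h P

theorem normalOrder_X_mul (ħ : ℝ) (i : Fin n) (P : Symbol n) :
    normalOrder n ħ (X i * P) = (-Complex.I * ħ) • (normalOrder n ħ P * pd i) := by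
  have h : normalOrder n ħ ∘ₗ mulSym (X i)
      = (-Complex.I * ħ) • (LinearMap.mulRight ℂ (pd i) ∘ₗ normalOrder n ħ) := by
    refine Symbol.hom_ext fun s b => ?_
    simp only [LinearMap.comp_apply, mulSym_apply, X, monomial_mul, normalOrder_monomial,
      LinearMap.smul_apply, LinearMap.mulRight_apply, one_mul]
    rw [add_comm, multiPd_add_single, map_add, Finsupp.degree_single, pow_succ', mul_smul,
      smul_mul_assoc, mul_assoc]
  exact LinearMap.congr_fun h P

theorem pd_mul_mulFun (i : Fin n) (b : Smooth n) :
    pd i * mulFun b = mulFun b * pd i + mulFun (pd i b) := by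
  refine LinearMap.ext fun f => ?_
  simp only [Module.End.mul_apply, mulFun_apply, LinearMap.add_apply, pd_mul, mul_comm f]

theorem normalOrder_C (ħ : ℝ) (a : Smooth n) : normalOrder n ħ (C a) = mulFun a := by
  rw [C_apply, normalOrder_monomial, multiPd_zero]
  simp

theorem pd_mul_normalOrder (ħ : ℝ) (i : Fin n) (P : Symbol n) :
    pd i * normalOrder n ħ P = normalOrder n ħ (dx i P) + normalOrder n ħ P * pd i := by
  induction P using MvPolynomial.induction_on with
  | C a =>
    have h : dx i (C a) = C (pd i a) := dx_monomial i 0 a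
    rw [h, normalOrder_C, normalOrder_C, pd_mul_mulFun, add_comm]
  | add P Q hP hQ => simp only [map_add, mul_add, add_mul, hP, hQ]; abel
  | mul_X P j hP =>
    rw [mul_comm P, dx_X_mul, normalOrder_X_mul, normalOrder_X_mul, mul_smul_comm, ← mul_assoc, hP,
      smul_mul_assoc, ← smul_add, add_mul, mul_assoc, pd_mul_pd, mul_assoc]

theorem normalOrder_induction {p : Symbol n → Prop} (hC : ∀ a, p (C a))
    (hadd : ∀ P Q, p P → p Q → p (P + Q)) (hX : ∀ P i, p P → p (X i * P)) (P : Symbol n) : p P :=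
  MvPolynomial.induction_on P hC hadd fun P i h => mul_comm P (X i) ▸ hX P i h

theorem dxi_C (i : Fin n) (a : Smooth n) : dxi i (C a) = 0 := pderiv_C

theorem sum_C_mul_dxi_X_mul (a : Fin n → Smooth n) (i : Fin n) (P : Symbol n) :
    ∑ j, C (a j) * dxi j (X i * P) = C (a i) * P + X i * ∑ j, C (a j) * dxi j P := by
  simp only [dxi_X_mul, mul_add, Finset.sum_add_distrib, Finset.mul_sum]
  refine congrArg₂ _ (by simp) (Finset.sum_congr rfl fun j _ => mul_left_comm _ _ _)

/-- By symmetry of `a` the two cross terms of the Leibniz rule coincide; their factor 2 later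
cancels the 1/2 of the second-order Taylor term. -/
theorem sum_C_mul_dxi_dxi_X_mul (a : Fin n → Fin n → Smooth n) (ha : ∀ j k, a j k = a k j)
    (i : Fin n) (P : Symbol n) :
    ∑ j, ∑ k, C (a j k) * dxi j (dxi k (X i * P))
      = (2 : ℂ) • ∑ j, C (a j i) * dxi j P + X i * ∑ j, ∑ k, C (a j k) * dxi j (dxi k P) := by
  have h (j : Fin n) : ∑ k, C (a j k) * dxi j (dxi k (X i * P))
      = C (a j i) * dxi j P + ((if j = i then ∑ k, C (a j k) * dxi k P else 0)
        + X i * ∑ k, C (a j k) * dxi j (dxi k P)) := by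
    have h' (k : Fin n) : C (a j k) * dxi j (dxi k (X i * P))
        = (if k = i then C (a j k) * dxi j P else 0)
          + ((if j = i then C (a j k) * dxi k P else 0) + X i * (C (a j k) * dxi j (dxi k P))) := by
      rw [dxi_X_mul k, map_add, dxi_X_mul j, mul_add, mul_add, mul_left_comm (X i)]
      split_ifs <;> simp
    simp only [h', Finset.sum_add_distrib, Finset.mul_sum, Finset.sum_ite_eq', Finset.mem_univ,
      if_true]
    split_ifs <;> simp
  simp only [h, Finset.sum_add_distrib, ← Finset.mul_sum, Finset.sum_ite_eq', Finset.mem_univ,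
    if_true, two_smul, ha i, add_assoc]

/-- The composition of a normal ordered operator with multiplication by a function whose third
derivatives vanish. -/
theorem normalOrder_mul_mulFun (ħ : ℝ) (P : Symbol n) (b : Smooth n)
    (hb : ∀ i j k, pd i (pd j (pd k b)) = 0) :
    normalOrder n ħ P * mulFun b
      = normalOrder n ħ (C b * P + (-Complex.I * ħ : ℂ) • ∑ j, C (pd j b) * dxi j P
        + ((-Complex.I * ħ : ℂ) ^ 2 / 2) • ∑ j, ∑ k, C (pd j (pd k b)) * dxi j (dxi k P)) := by
  -- The function must vary: moving `pd i` past `b` produces `pd i b`, to which the induction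
  -- hypothesis is applied as well.
  induction P using normalOrder_induction generalizing b with
  | hC a =>
    simp only [dxi_C, mul_zero, map_zero, Finset.sum_const_zero, smul_zero, add_zero]
    rw [← C_mul, normalOrder_C, normalOrder_C]
    exact LinearMap.ext fun f => (mul_left_comm a b f).trans (mul_assoc b a f).symm
  | hadd P Q hP hQ =>
    rw [map_add, add_mul, hP b hb, hQ b hb, ← map_add]
    refine congrArg _ ?_
    simp only [map_add, mul_add, Finset.sum_add_distrib, smul_add]
    abel
  | hX P i hP =>
    have hbi : ∀ j k l, pd j (pd k (pd l (pd i b))) = 0 := fun j k l => by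
      rw [pd_comm l i, hb, map_zero]
    have h3 := hP (pd i b) hbi
    -- For `pd i b` the second derivatives already vanish, so its expansion stops at first order.
    simp only [fun j k => show pd j (pd k (pd i b)) = 0 from hb j k i,
      map_zero, zero_mul, Finset.sum_const_zero, smul_zero, add_zero] at h3
    rw [normalOrder_X_mul, smul_mul_assoc, mul_assoc, pd_mul_mulFun, mul_add, ← mul_assoc, hP b hb,
      h3, smul_add, ← normalOrder_X_mul, ← map_smul, ← map_add, sum_C_mul_dxi_X_mul,
      sum_C_mul_dxi_dxi_X_mul _ (fun j k => pd_comm j k b)]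
    refine congrArg _ ?_
    generalize (-Complex.I * ħ : ℂ) = θ
    simp only [smul_add, mul_add, smul_smul, mul_smul_comm]
    rw [show θ ^ 2 / 2 * 2 = θ * θ by ring, mul_left_comm]
    abel

end

/-! ### Projective fields acting on symbols and on normal ordered operators. -/

section

variable {n : ℕ}

/-- The second derivatives of the vector field `X` are those of the projective vector field
`αⱼ xʲ xⁱ ∂ᵢ`. -/
def HasProjHessian (X : VField n) (α : Fin n → ℂ) : Prop :=
  ∀ i j k, pd j (pd k (X i))
    = algebraMap ℂ (Smooth n) ((if i = k then α j else 0) + if i = j then α k else 0)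

/-- The constant coefficient operator `αⱼ ∂/∂ξⱼ`. -/
def dirDxi (α : Fin n → ℂ) : Module.End ℂ (Symbol n) := ∑ j, α j • dxi j

theorem dirDxi_apply (α : Fin n → ℂ) (P : Symbol n) : dirDxi α P = ∑ j, α j • dxi j P := by
  simp [dirDxi]

theorem C_algebraMap_mul (c : ℂ) (P : Symbol n) : C (algebraMap ℂ (Smooth n) c) * P = c • P := by
  rw [Algebra.smul_def, IsScalarTower.algebraMap_apply ℂ (Smooth n) (Symbol n)]
  rfl

theorem HasProjHessian.zero : HasProjHessian (0 : VField n) 0 := fun i j k => by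
  simp

theorem HasProjHessian.add {X Y : VField n} {α β : Fin n → ℂ} (hX : HasProjHessian X α)
    (hY : HasProjHessian Y β) : HasProjHessian (X + Y) (α + β) := fun i j k => by
  rw [Pi.add_apply, map_add, map_add, hX, hY, ← map_add]
  refine congrArg _ ?_
  simp only [Pi.add_apply]
  split_ifs <;> ring

theorem HasProjHessian.smul {X : VField n} {α : Fin n → ℂ} (hX : HasProjHessian X α) (c : ℂ) :
    HasProjHessian (c • X) (c • α) := fun i j k => by
  rw [Pi.smul_apply, map_smul, map_smul, hX, Algebra.smul_def, ← map_mul]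
  simp [mul_add]

/-- The condition is linear in the pair (X, α). Constant and linear generators have α = 0, and the
quadratic generator with index `a` has the basis covector at `a`. -/
theorem exists_hasProjHessian {X : VField n} (hX : X ∈ projectiveFields n) :
    ∃ α, HasProjHessian X α := by
  induction hX using Submodule.span_induction with
  | zero => exact ⟨0, .zero⟩
  | add X Y _ _ hX hY =>
    obtain ⟨α, hα⟩ := hX
    obtain ⟨β, hβ⟩ := hY
    exact ⟨_, hα.add hβ⟩
  | smul c X _ hX =>
    obtain ⟨α, hα⟩ := hX
    exact ⟨_, hα.smul (c : ℂ)⟩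
  | mem X hX =>
    rcases hX with (⟨a, rfl⟩ | ⟨⟨a, b⟩, rfl⟩) | ⟨a, rfl⟩
    · refine ⟨0, fun i j k => ?_⟩
      by_cases h : i = a
      · subst h; simp [pd_one]
      · simp [h]
    · refine ⟨0, fun i j k => ?_⟩
      by_cases h : i = b
      · subst h
        simp only [Pi.single_eq_same, pd_coord]
        split_ifs <;> simp [pd_one]
      · simp [h]
    · refine ⟨Pi.single a 1, fun i j k => ?_⟩
      have h0 (p : Prop) [Decidable p] : pd j (if p then (1 : Smooth n) else 0) = 0 := by
        split_ifs <;> simp [pd_one]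
      simp only [pd_mul, map_add, pd_coord, Pi.single_apply, h0, mul_zero, zero_add,
        eq_comm (a := i)]
      split_ifs <;> simp

variable {X : VField n} {α : Fin n → ℂ}

theorem HasProjHessian.pd_pd_pd (hX : HasProjHessian X α) (i j k l : Fin n) :
    pd j (pd k (pd l (X i))) = 0 := by
  rw [hX, pd_algebraMap]

/-- Tracing the Hessian, one Kronecker term contributes n αⱼ and the other αⱼ; this is the source of
every n + 1 in the coefficients. -/
theorem HasProjHessian.pd_div (hX : HasProjHessian X α) (j : Fin n) :
    pd j X.div = algebraMap ℂ (Smooth n) ((n + 1) * α j) := by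
  simp only [VField.div, map_sum, hX _ _ _]
  rw [← map_sum]
  refine congrArg _ ?_
  simp [Finset.sum_add_distrib, add_mul]

/-- Both Kronecker terms contract to ∂/∂ξᵢ composed with `dirDxi α`, and ξᵢ∂/∂ξᵢ then assembles into
the Euler operator. -/
theorem HasProjHessian.sum_C_mul_X_mul_dxi (hX : HasProjHessian X α) (P : Symbol n) :
    ∑ i, MvPolynomial.X i * ∑ j, ∑ k, C (pd j (pd k (X i))) * dxi j (dxi k P)
      = (2 : ℂ) • euler n (dirDxi α P) := by
  have h1 (i : Fin n) : ∑ j, ∑ k, C (pd j (pd k (X i))) * dxi j (dxi k P)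
      = (2 : ℂ) • dxi i (dirDxi α P) := by
    simp only [hX _ _ _, C_algebraMap_mul, add_smul, Finset.sum_add_distrib, ite_smul, zero_smul,
      dirDxi_apply, map_sum, map_smul, two_smul]
    refine congrArg₂ _ ?_ ?_
    · exact Finset.sum_congr rfl fun j _ => by simp [dxi_comm j i]
    · rw [Finset.sum_comm]
      exact Finset.sum_congr rfl fun j _ => by simp
  simp only [h1, euler, LinearMap.sum_apply, Module.End.mul_apply, mulSym_apply, Finset.smul_sum,
    mul_smul_comm]

theorem lieSymbol_apply (δ : ℂ) (X : VField n) (P : Symbol n) :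
    lieSymbol δ X P = ∑ i, C (X i) * dx i P
      - ∑ i, MvPolynomial.X i * ∑ j, C (pd j (X i)) * dxi j P + δ • (C X.div * P) := by
  simp only [lieSymbol, LinearMap.add_apply, LinearMap.sub_apply, LinearMap.sum_apply,
    Module.End.mul_apply, mulSym_apply, LinearMap.smul_apply, Finset.mul_sum]
  refine congrArg₂ _ (congrArg₂ _ rfl ?_) rfl
  exact Finset.sum_congr rfl fun i _ => Finset.sum_congr rfl fun j _ => by ring

/-- The first-order part of the composition rule yields the classical action. The correction has two
sources: the second-order part for Xⁱ gives the Euler term, and the gradient of the divergence,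
weighted by `lam`, gives the constant (n+1)λ. -/
theorem HasProjHessian.lieOp_normalOrder (hX : HasProjHessian X α) (ħ : ℝ) (lam mu : ℂ)
    (P : Symbol n) :
    lieOp lam mu X (normalOrder n ħ P) = normalOrder n ħ (lieSymbol (mu - lam) X P
      - (-Complex.I * ħ : ℂ) • eulerFun n (fun k => k + (n + 1) * lam) (dirDxi α P)) := by
  set θ : ℂ := -Complex.I * ħ with hθ
  have hI (i : Fin n) (R : Symbol n) : normalOrder n ħ (θ • R) * pd i
      = normalOrder n ħ (MvPolynomial.X i * R) := by
    rw [normalOrder_X_mul, map_smul, smul_mul_assoc]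
  have h1 (i : Fin n) : mulFun (X i) * pd i * normalOrder n ħ P
      - normalOrder n ħ P * (mulFun (X i) * pd i)
      = normalOrder n ħ (C (X i) * dx i P - MvPolynomial.X i * ∑ j, C (pd j (X i)) * dxi j P
        - (θ / 2) • (MvPolynomial.X i * ∑ j, ∑ k, C (pd j (pd k (X i))) * dxi j (dxi k P))) := by
    -- One factor θ is split off the correction terms so that, with `pd i`, it becomes
    -- multiplication by ξᵢ through `hI`; this leaves θ/2 on the second-order part.
    rw [mul_assoc, pd_mul_normalOrder, mul_add, ← normalOrder_C_mul, ← mul_assoc, ← mul_assoc,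
      ← normalOrder_C_mul, normalOrder_mul_mulFun ħ P (X i) (hX.pd_pd_pd i), ← hθ, add_assoc,
      show θ ^ 2 / 2 = θ * (θ / 2) by ring, mul_smul θ, ← smul_add, map_add _ (C (X i) * P), add_mul,
      hI, mul_add, mul_smul_comm, map_sub, map_sub, map_add]
    abel
  have h2 : normalOrder n ħ P * mulFun X.div
      = normalOrder n ħ (C X.div * P + (θ * (n + 1)) • dirDxi α P) := by
    rw [normalOrder_mul_mulFun ħ P X.div fun i j k => by rw [hX.pd_div, pd_algebraMap, map_zero],
      ← hθ]
    simp only [hX.pd_div, pd_algebraMap, map_zero, zero_mul, Finset.sum_const_zero, smul_zero,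
      add_zero, C_algebraMap_mul, dirDxi_apply, mul_smul, Finset.smul_sum]
  have h3 : eulerFun n (fun k => k + (n + 1) * lam) (dirDxi α P)
      = euler n (dirDxi α P) + ((n + 1) * lam) • dirDxi α P := by
    rw [euler_eq, show (fun k : ℕ => (k : ℂ) + (n + 1) * lam)
      = (fun k : ℕ => (k : ℂ)) + algebraMap ℂ (ℕ → ℂ) ((n + 1) * lam) from rfl, map_add,
      AlgHom.commutes]
    rfl
  have h4 : lieOp lam mu X (normalOrder n ħ P)
      = ∑ i, (mulFun (X i) * pd i * normalOrder n ħ P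
        - normalOrder n ħ P * (mulFun (X i) * pd i))
        + (mu • (mulFun X.div * normalOrder n ħ P) - lam • (normalOrder n ħ P * mulFun X.div)) := by
    simp only [lieOp, lieDensity, add_mul, mul_add, Finset.sum_mul, Finset.mul_sum, smul_mul_assoc,
      mul_smul_comm, Finset.sum_sub_distrib]
    abel
  rw [h4, Finset.sum_congr rfl fun i _ => h1 i, h2, h3, ← normalOrder_C_mul, ← map_sum, ← map_smul,
    ← map_smul, ← map_sub, ← map_add]
  refine congrArg _ ?_
  rw [Finset.sum_sub_distrib, Finset.sum_sub_distrib, ← Finset.smul_sum, hX.sum_C_mul_X_mul_dxi,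
    lieSymbol_apply]
  module

theorem dx_lieSymbol (δ : ℂ) (k : Fin n) (P : Symbol n) (X : VField n) :
    dx k (lieSymbol δ X P) = lieSymbol δ X (dx k P) + (∑ i, C (pd k (X i)) * dx i P
      - ∑ i, MvPolynomial.X i * ∑ j, C (pd k (pd j (X i))) * dxi j P
      + δ • (C (pd k X.div) * P)) := by
  simp only [lieSymbol_apply, map_add, map_sub, map_sum, map_smul, dx_C_mul, dx_X_mul, dx_dxi,
    dx_comm k, Finset.sum_add_distrib, mul_add, smul_add]
  abel

theorem dxi_lieSymbol (δ : ℂ) (k : Fin n) (P : Symbol n) (X : VField n) :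
    dxi k (lieSymbol δ X P) = lieSymbol δ X (dxi k P) - ∑ j, C (pd j (X k)) * dxi j P := by
  simp only [lieSymbol_apply, map_add, map_sub, map_sum, map_smul, dxi_C_mul, dxi_X_mul, ← dx_dxi,
    dxi_comm k, Finset.sum_add_distrib, Finset.sum_ite_eq, Finset.mem_univ, if_true]
  abel

/-- Terms with first derivatives of X cancel in pairs (`e1`). The second derivatives survive: -2E
from `e2`, (n+1)δ from `e3` and -(n+1) from `e4`, each applied to `dirDxi α`. -/
theorem HasProjHessian.divergence_lieSymbol (hX : HasProjHessian X α) (δ : ℂ) :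
    divergence n * lieSymbol δ X = lieSymbol δ X * divergence n
      - eulerFun n (fun k => 2 * k + (n + 1) * (1 - δ)) * dirDxi α := by
  refine LinearMap.ext fun P => ?_
  have h3 : eulerFun n (fun k => 2 * k + (n + 1) * (1 - δ)) (dirDxi α P)
      = (2 : ℂ) • euler n (dirDxi α P) + ((n + 1) * (1 - δ)) • dirDxi α P := by
    rw [euler_eq, show (fun k : ℕ => 2 * (k : ℂ) + (n + 1) * (1 - δ))
      = (2 : ℂ) • (fun k : ℕ => (k : ℂ)) + algebraMap ℂ (ℕ → ℂ) ((n + 1) * (1 - δ)) from rfl,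
      map_add, map_smul, AlgHom.commutes]
    rfl
  have h (k : Fin n) : dx k (dxi k (lieSymbol δ X P)) = lieSymbol δ X (dx k (dxi k P))
      + ∑ i, C (pd k (X i)) * dx i (dxi k P)
      - ∑ i, MvPolynomial.X i * ∑ j, C (pd k (pd j (X i))) * dxi j (dxi k P)
      + δ • (C (pd k X.div) * dxi k P)
      - ∑ j, C (pd k (pd j (X k))) * dxi j P
      - ∑ j, C (pd j (X k)) * dx k (dxi j P) := by
    rw [dxi_lieSymbol, map_sub, dx_lieSymbol]
    simp only [map_sum, dx_C_mul, Finset.sum_add_distrib]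
    abel
  simp only [divergence, LinearMap.sub_apply, Module.End.mul_apply, LinearMap.sum_apply, h, map_sum,
    Finset.sum_sub_distrib, Finset.sum_add_distrib]
  have e1 : ∑ k, ∑ i, C (pd k (X i)) * dx i (dxi k P) = ∑ k, ∑ j, C (pd j (X k)) * dx k (dxi j P) :=
    Finset.sum_comm
  have e2 : ∑ k, ∑ i, MvPolynomial.X i * ∑ j, C (pd k (pd j (X i))) * dxi j (dxi k P)
      = (2 : ℂ) • euler n (dirDxi α P) := by
    rw [← hX.sum_C_mul_X_mul_dxi, Finset.sum_comm]
    simp only [← Finset.mul_sum, dxi_comm]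
  have e3 : ∑ k, δ • (C (pd k X.div) * dxi k P) = (δ * (n + 1)) • dirDxi α P := by
    simp only [hX.pd_div, C_algebraMap_mul, dirDxi_apply, mul_smul, Finset.smul_sum]
  have e4 : ∑ k, ∑ j, C (pd k (pd j (X k))) * dxi j P = (n + 1 : ℂ) • dirDxi α P := by
    rw [Finset.sum_comm]
    rw [dirDxi_apply, Finset.smul_sum]
    refine Finset.sum_congr rfl fun j _ => ?_
    rw [smul_smul, ← C_algebraMap_mul, ← hX.pd_div, VField.div, map_sum, map_sum, Finset.sum_mul]
    exact Finset.sum_congr rfl fun k _ => by rw [pd_comm]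
  rw [e1, e2, e3, e4, h3]
  module

end

/-! ### Commutation with functions of the Euler operator and powers of the divergence. -/

section

variable {n : ℕ} {X : VField n} {α : Fin n → ℂ}

theorem divergence_eulerFun (f : ℕ → ℂ) :
    divergence n * eulerFun n f = eulerFun n (fun k => f (k + 1)) * divergence n := by
  simp only [divergence, Finset.sum_mul, Finset.mul_sum, mul_assoc, dxi_eulerFun]
  simp only [← mul_assoc, dx_eulerFun]

theorem divergence_pow_eulerFun (m : ℕ) (f : ℕ → ℂ) :
    divergence n ^ m * eulerFun n f = eulerFun n (fun k => f (k + m)) * divergence n ^ m := by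
  induction m generalizing f with
  | zero => simp
  | succ m ih =>
    rw [pow_succ, mul_assoc, divergence_eulerFun, ← mul_assoc, ih, mul_assoc]
    simp only [add_assoc]

theorem dirDxi_eulerFun (α : Fin n → ℂ) (f : ℕ → ℂ) :
    dirDxi α * eulerFun n f = eulerFun n (fun k => f (k + 1)) * dirDxi α := by
  simp only [dirDxi, Finset.sum_mul, Finset.mul_sum, smul_mul_assoc, mul_smul_comm, dxi_eulerFun]

theorem divergence_dirDxi (α : Fin n → ℂ) :
    divergence n * dirDxi α = dirDxi α * divergence n := by
  refine LinearMap.ext fun P => ?_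
  simp only [divergence, Module.End.mul_apply, LinearMap.sum_apply, dirDxi_apply, map_sum, map_smul,
    Finset.smul_sum, dx_dxi]
  rw [Finset.sum_comm]
  simp only [dxi_comm]

theorem lieSymbol_eulerFun (δ : ℂ) (X : VField n) (f : ℕ → ℂ) :
    lieSymbol δ X * eulerFun n f = eulerFun n f * lieSymbol δ X := by
  have h (i j : Fin n) (a : Smooth n) :
      mulSym (C a * MvPolynomial.X i) * dxi j * eulerFun n f
        = eulerFun n f * (mulSym (C a * MvPolynomial.X i) * dxi j) := by
    have hm : mulSym (C a * MvPolynomial.X i) = mulSym (C a) * mulSym (MvPolynomial.X i) :=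
      LinearMap.ext fun P => mul_assoc _ _ P
    rw [hm, mul_assoc, dxi_eulerFun, mul_assoc, ← mul_assoc (mulSym (MvPolynomial.X i)),
      mulSym_X_eulerFun, ← mul_assoc, ← mul_assoc, mulSym_C_eulerFun]
    simp only [mul_assoc]
  simp only [lieSymbol, add_mul, sub_mul, mul_add, mul_sub, Finset.sum_mul, Finset.mul_sum,
    smul_mul_assoc, mul_smul_comm, h, mulSym_C_eulerFun]
  simp only [mul_assoc, dx_eulerFun]
  simp only [← mul_assoc, mulSym_C_eulerFun]

/-- Each further divergence shifts the Euler operator by one, so the factor is the arithmetic sum of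
2(k+j) + (n+1)(1-δ) over j = 0, …, m. -/
theorem HasProjHessian.divergence_pow_lieSymbol (hX : HasProjHessian X α) (δ : ℂ) (m : ℕ) :
    divergence n ^ (m + 1) * lieSymbol δ X = lieSymbol δ X * divergence n ^ (m + 1)
      - eulerFun n (fun k => (m + 1) * (2 * k + m + (n + 1) * (1 - δ)))
        * dirDxi α * divergence n ^ m := by
  induction m with
  | zero => simpa using hX.divergence_lieSymbol δ
  | succ m ih =>
    rw [pow_succ', mul_assoc, ih, mul_sub, ← mul_assoc, hX.divergence_lieSymbol, sub_mul, mul_assoc,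
      ← pow_succ', ← mul_assoc, ← mul_assoc, divergence_eulerFun,
      mul_assoc (eulerFun n _) (divergence n), divergence_dirDxi, ← mul_assoc (eulerFun n _),
      mul_assoc _ (divergence n), ← pow_succ', sub_sub, ← add_mul, ← add_mul, ← map_add]
    refine congrArg (fun f => _ - eulerFun n f * _ * _) (funext fun k => ?_)
    simp only [Pi.add_apply]
    push_cast
    ring

/-! ### The coefficients degree by degree and their recurrence. -/

theorem ascPochhammer_succ_eval_left (m : ℕ) (a : ℂ) :
    (ascPochhammer ℂ (m + 1)).eval a = a * (ascPochhammer ℂ m).eval (a + 1) := by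
  simp [ascPochhammer_succ_left, Polynomial.eval_comp]

theorem ascPochhammer_eval_ne_zero {a : ℂ} (m : ℕ) (h : ∀ j < m, a + j ≠ 0) :
    (ascPochhammer ℂ m).eval a ≠ 0 := by
  induction m with
  | zero => simp
  | succ m ih =>
    rw [ascPochhammer_succ_eval]
    exact mul_ne_zero (ih fun j hj => h j (hj.trans m.lt_succ_self)) (h m m.lt_succ_self)

theorem opPochhammer_eulerFun (f : ℕ → ℂ) (m : ℕ) :
    opPochhammer (eulerFun n f) m = eulerFun n (fun k => (ascPochhammer ℂ m).eval (f k)) := by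
  rw [opPochhammer, Polynomial.aeval_algHom_apply]
  refine congrArg _ (funext fun k => ?_)
  -- A polynomial in a sequence is computed pointwise because evaluation at `k` is an algebra map.
  have h := Polynomial.aeval_algHom_apply (Pi.evalAlgHom ℂ (fun _ : ℕ => ℂ) k) f (ascPochhammer ℂ m)
  rw [Pi.evalAlgHom_apply, Pi.evalAlgHom_apply] at h
  rw [← h, Polynomial.coe_aeval_eq_eval]

/-- The value of the denominator in degree `k`. -/
def denValue (n : ℕ) (δ : ℂ) (m k : ℕ) : ℂ :=
  (ascPochhammer ℂ m).eval (2 * k + ((n + 1) * (1 - δ) + m - 1))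

/-- The value of the coefficient `C_m(E)` in degree `k`. -/
def coeffValue (n : ℕ) (lam mu : ℂ) (m k : ℕ) : ℂ :=
  1 / (m.factorial : ℂ) * ((ascPochhammer ℂ m).eval (k + (n + 1) * lam)
    * (denValue n (mu - lam) m k)⁻¹)

theorem coeffDen_eq (n : ℕ) (δ : ℂ) (m : ℕ) : coeffDen n δ m = eulerFun n (denValue n δ m) := by
  rw [coeffDen, euler_eq, ← map_smul, ← AlgHom.commutes (eulerFun n), ← map_add,
    opPochhammer_eulerFun]
  rfl

theorem coeffNum_eq (n : ℕ) (lam : ℂ) (m : ℕ) :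
    coeffNum n lam m = eulerFun n fun k => (ascPochhammer ℂ m).eval (k + (n + 1) * lam) := by
  rw [coeffNum, euler_eq, ← AlgHom.commutes (eulerFun n), ← map_add, opPochhammer_eulerFun]
  rfl

theorem weight_ne_zero {δ : ℂ} (hδ : ∀ l : ℕ, δ ≠ 1 + (l : ℂ) / ((n : ℂ) + 1)) (l : ℕ) :
    (n + 1) * (1 - δ) + l ≠ 0 := by
  intro h
  have hn : (n : ℂ) + 1 ≠ 0 := n.cast_add_one_ne_zero
  refine hδ l ?_
  field_simp
  linear_combination -h

theorem denValue_ne_zero {δ : ℂ} (hδ : ∀ l : ℕ, δ ≠ 1 + (l : ℂ) / ((n : ℂ) + 1)) (m k : ℕ) :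
    denValue n δ m k ≠ 0 := by
  refine ascPochhammer_eval_ne_zero m fun j hj => ?_
  -- A factor exists only for m ≥ 1, which makes the shift 2k + m - 1 + j a natural number, as the
  -- condition on δ requires.
  obtain ⟨m, rfl⟩ : ∃ p, m = p + 1 := ⟨m - 1, by omega⟩
  convert weight_ne_zero hδ (2 * k + m + j) using 1
  push_cast
  ring

theorem isUnit_coeffDen {δ : ℂ} (hδ : ∀ l : ℕ, δ ≠ 1 + (l : ℂ) / ((n : ℂ) + 1)) (m : ℕ) :
    IsUnit (coeffDen n δ m) := by
  rw [coeffDen_eq]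
  exact (Pi.isUnit_iff.mpr fun k => (denValue_ne_zero hδ m k).isUnit).map _

/-- The pointwise reciprocals give a right inverse of the denominator, and cancelling that unit
identifies it with `Ring.inverse`. -/
theorem coeffOp_eq {lam mu : ℂ} (hδ : ∀ l : ℕ, mu - lam ≠ 1 + (l : ℂ) / ((n : ℂ) + 1)) (m : ℕ) :
    coeffOp n lam mu m = eulerFun n (coeffValue n lam mu m) := by
  have hinv : Ring.inverse (coeffDen n (mu - lam) m)
      = eulerFun n fun k => (denValue n (mu - lam) m k)⁻¹ := by
    have h1 : coeffDen n (mu - lam) m * eulerFun n (fun k => (denValue n (mu - lam) m k)⁻¹) = 1 := by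
      rw [coeffDen_eq, ← map_mul, ← map_one (eulerFun n)]
      exact congrArg _ (funext fun k => mul_inv_cancel₀ (denValue_ne_zero hδ m k))
    rw [← (isUnit_coeffDen hδ m).mul_right_inj, h1, Ring.mul_inverse_cancel _ (isUnit_coeffDen hδ m)]
  rw [coeffOp, hinv, coeffNum_eq, ← map_mul, ← map_smul]
  rfl

theorem coeffValue_zero (n : ℕ) (lam mu : ℂ) (k : ℕ) : coeffValue n lam mu 0 k = 1 := by
  simp [coeffValue, denValue]

/-- Removing the first factor of the denominator for (m+1, k) leaves exactly the one for (m, k+1),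
since 2k + m + 1 = 2(k+1) + m - 1; the numerator behaves likewise. -/
theorem coeffValue_succ {lam mu : ℂ} (hδ : ∀ l : ℕ, mu - lam ≠ 1 + (l : ℂ) / ((n : ℂ) + 1))
    (m k : ℕ) :
    coeffValue n lam mu (m + 1) k * ((m + 1) * (2 * k + m + (n + 1) * (1 - (mu - lam))))
      = (k + (n + 1) * lam) * coeffValue n lam mu m (k + 1) := by
  have hd : denValue n (mu - lam) (m + 1) k
      = (2 * k + m + (n + 1) * (1 - (mu - lam))) * denValue n (mu - lam) m (k + 1) := by
    rw [denValue, denValue, ascPochhammer_succ_eval_left]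
    refine congrArg₂ (fun a b => a * (ascPochhammer ℂ m).eval b) ?_ ?_ <;> (push_cast; ring)
  have h0 : denValue n (mu - lam) (m + 1) k ≠ 0 := denValue_ne_zero hδ _ _
  rw [hd] at h0
  have h1 := left_ne_zero_of_mul h0
  have h2 := right_ne_zero_of_mul h0
  have hm : (m : ℂ) + 1 ≠ 0 := m.cast_add_one_ne_zero
  have hf : (m.factorial : ℂ) ≠ 0 := Nat.cast_ne_zero.mpr m.factorial_ne_zero
  rw [coeffValue, coeffValue, hd, ascPochhammer_succ_eval_left, Nat.factorial_succ]
  have e : ((k + 1 : ℕ) : ℂ) + (n + 1) * lam = k + (n + 1) * lam + 1 := by push_cast; ring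
  rw [e]
  generalize denValue n (mu - lam) m (k + 1) = d at *
  generalize (ascPochhammer ℂ m).eval (k + (n + 1) * lam + 1) = p at *
  generalize 2 * (k : ℂ) + m + (n + 1) * (1 - (mu - lam)) = q at *
  push_cast
  field_simp

/-! ### The series, its equivariance and its principal symbol. -/

/-- The partial sums of the series. -/
def partialSeries (n : ℕ) (θ lam mu : ℂ) (N : ℕ) : Module.End ℂ (Symbol n) :=
  ∑ m ∈ Finset.range (N + 1), θ ^ m • (eulerFun n (coeffValue n lam mu m) * divergence n ^ m)

/-- A telescoping sum with explicit remainder: the defect of the term N + 1 cancels the remainder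
left by the first N terms. -/
theorem HasProjHessian.partialSeries_lieSymbol (hX : HasProjHessian X α) {lam mu : ℂ}
    (hδ : ∀ l : ℕ, mu - lam ≠ 1 + (l : ℂ) / ((n : ℂ) + 1)) (θ : ℂ) (N : ℕ) :
    partialSeries n θ lam mu N * lieSymbol (mu - lam) X
      = (lieSymbol (mu - lam) X - θ • (eulerFun n (fun k => k + (n + 1) * lam) * dirDxi α))
          * partialSeries n θ lam mu N
        + θ ^ (N + 1) • (eulerFun n (fun k => (k + (n + 1) * lam) * coeffValue n lam mu N (k + 1))
          * (dirDxi α * divergence n ^ N)) := by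
  -- Moving `dirDxi α` past a coefficient shifts its argument to k + 1, giving the right side of
  -- `coeffValue_succ`.
  have hc (m : ℕ) : (eulerFun n (fun k => k + (n + 1) * lam) * dirDxi α)
      * (eulerFun n (coeffValue n lam mu m) * divergence n ^ m)
      = eulerFun n (fun k => (k + (n + 1) * lam) * coeffValue n lam mu m (k + 1))
          * (dirDxi α * divergence n ^ m) := by
    rw [mul_assoc, ← mul_assoc (dirDxi α), dirDxi_eulerFun, mul_assoc, ← mul_assoc, ← map_mul]
    rfl
  induction N with
  | zero =>
    have h0 : coeffValue n lam mu 0 = 1 := funext (coeffValue_zero n lam mu)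
    simp [partialSeries, h0]
  | succ N ih =>
    have hs : partialSeries n θ lam mu (N + 1) = partialSeries n θ lam mu N
        + θ ^ (N + 1) • (eulerFun n (coeffValue n lam mu (N + 1)) * divergence n ^ (N + 1)) :=
      Finset.sum_range_succ _ _
    have h1 : eulerFun n (coeffValue n lam mu (N + 1)) * divergence n ^ (N + 1)
          * lieSymbol (mu - lam) X
        = lieSymbol (mu - lam) X
            * (eulerFun n (coeffValue n lam mu (N + 1)) * divergence n ^ (N + 1))
          - eulerFun n (fun k => (k + (n + 1) * lam) * coeffValue n lam mu N (k + 1))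
            * (dirDxi α * divergence n ^ N) := by
      rw [mul_assoc, hX.divergence_pow_lieSymbol, mul_sub, ← mul_assoc, ← lieSymbol_eulerFun,
        mul_assoc, mul_assoc (eulerFun n _) (dirDxi α), ← mul_assoc (eulerFun n _) (eulerFun n _),
        ← map_mul]
      exact congrArg (fun f => _ - eulerFun n f * _) (funext (coeffValue_succ hδ N))
    rw [hs, add_mul, ih, smul_mul_assoc, h1, mul_add, mul_smul_comm (θ ^ (N + 1)),
      sub_mul _ _ (eulerFun n (coeffValue n lam mu (N + 1)) * _), smul_mul_assoc θ _ (_ * _), hc,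
      pow_succ θ (N + 1)]
    module

/-- The whole series, which is a finite sum on each symbol. -/
def series (n : ℕ) (θ lam mu : ℂ) : Module.End ℂ (Symbol n) :=
  Symbol.lift fun s => partialSeries n θ lam mu s.degree ∘ₗ (monomial s).restrictScalars ℂ

/-- The projector onto degrees at most N is a function of the Euler operator, so degree bounds and
vanishing statements reduce to the commutation rules. -/
theorem eulerFun_of_totalDegree_le {N : ℕ} {P : Symbol n} (hP : P.totalDegree ≤ N) :
    eulerFun n (fun k => if k ≤ N then 1 else 0) P = P := by
  have h : eulerFun n (fun k => if k ≤ N then 1 else 0) P = eulerFun n 1 P :=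
    eulerFun_congr hP fun k hk => if_pos hk
  rw [h, map_one, Module.End.one_apply]

theorem divergence_pow_apply_eq_zero {N m : ℕ} (hm : N < m) {P : Symbol n} (hP : P.totalDegree ≤ N) :
    (divergence n ^ m) P = 0 := by
  have h := (eulerFun_of_totalDegree_le hP).symm
  rw [h, ← Module.End.mul_apply, divergence_pow_eulerFun,
    show (fun k => if k + m ≤ N then (1 : ℂ) else 0) = 0 from funext fun k => if_neg (by omega)]
  simp

theorem dirDxi_divergence_pow_apply_eq_zero {N : ℕ} {P : Symbol n} (hP : P.totalDegree ≤ N)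
    (α : Fin n → ℂ) : dirDxi α ((divergence n ^ N) P) = 0 := by
  have h := (eulerFun_of_totalDegree_le hP).symm
  rw [h, ← Module.End.mul_apply (divergence n ^ N), divergence_pow_eulerFun, ← Module.End.mul_apply,
    ← mul_assoc, dirDxi_eulerFun,
    show (fun k => if k + 1 + N ≤ N then (1 : ℂ) else 0) = 0 from funext fun k => if_neg (by omega)]
  simp

theorem partialSeries_apply_eq {N M : ℕ} (h : N ≤ M) {P : Symbol n} (hP : P.totalDegree ≤ N)
    (θ lam mu : ℂ) : partialSeries n θ lam mu M P = partialSeries n θ lam mu N P := by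
  simp only [partialSeries, LinearMap.sum_apply]
  refine (Finset.sum_subset (Finset.range_mono (by omega)) fun m _ hm => ?_).symm
  rw [LinearMap.smul_apply, Module.End.mul_apply,
    divergence_pow_apply_eq_zero (by simpa using hm) hP, map_zero, smul_zero]

theorem series_apply {N : ℕ} {P : Symbol n} (hP : P.totalDegree ≤ N) (θ lam mu : ℂ) :
    series n θ lam mu P = partialSeries n θ lam mu N P := by
  rw [P.as_sum, map_sum, map_sum]
  refine Finset.sum_congr rfl fun s hs => ?_
  rw [series, Symbol.lift_monomial]
  exact (partialSeries_apply_eq ((le_totalDegree hs).trans hP) (totalDegree_monomial_le _ _) _ _ _).symm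

theorem totalDegree_le_of_eulerFun {N : ℕ} {P : Symbol n}
    (h : eulerFun n (fun k => if k ≤ N then 1 else 0) P = P) : P.totalDegree ≤ N := by
  rw [← h, P.as_sum, map_sum]
  refine totalDegree_finsetSum_le fun s _ => ?_
  rw [eulerFun_monomial]
  split_ifs with hs
  · rw [one_smul]
    exact (totalDegree_monomial_le _ _).trans hs
  · simp

theorem totalDegree_lieSymbol_le {N : ℕ} {P : Symbol n} (hP : P.totalDegree ≤ N) (δ : ℂ)
    (X : VField n) : (lieSymbol δ X P).totalDegree ≤ N := by
  refine totalDegree_le_of_eulerFun ?_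
  rw [← Module.End.mul_apply, ← lieSymbol_eulerFun, Module.End.mul_apply,
    eulerFun_of_totalDegree_le hP]

theorem HasProjHessian.normalOrder_series_lieSymbol (hX : HasProjHessian X α) {lam mu : ℂ}
    (hδ : ∀ l : ℕ, mu - lam ≠ 1 + (l : ℂ) / ((n : ℂ) + 1)) (ħ : ℝ) (P : Symbol n) :
    normalOrder n ħ (series n (-Complex.I * ħ) lam mu (lieSymbol (mu - lam) X P))
      = lieOp lam mu X (normalOrder n ħ (series n (-Complex.I * ħ) lam mu P)) := by
  rw [hX.lieOp_normalOrder, series_apply (totalDegree_lieSymbol_le le_rfl _ _),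
    series_apply le_rfl, ← Module.End.mul_apply, hX.partialSeries_lieSymbol hδ]
  refine congrArg _ ?_
  simp only [LinearMap.add_apply, Module.End.mul_apply, LinearMap.smul_apply, LinearMap.sub_apply,
    dirDxi_divergence_pow_apply_eq_zero le_rfl, map_zero, smul_zero, add_zero]

theorem normalOrder_mem_diffOpLT (ħ : ℝ) {k : ℕ} {P : Symbol n} (hP : P.totalDegree < k) :
    normalOrder n ħ P ∈ diffOpLT n k := by
  rw [P.as_sum, map_sum]
  refine Submodule.sum_mem _ fun s hs => ?_
  rw [normalOrder_monomial]
  exact Submodule.smul_mem _ _ (Submodule.subset_span ⟨_, s, (le_totalDegree hs).trans_lt hP, rfl⟩)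

theorem normalOrder_mem_diffOp (ħ : ℝ) (P : Symbol n) : normalOrder n ħ P ∈ diffOp n :=
  Submodule.mem_iSup_of_mem (P.totalDegree + 1) (normalOrder_mem_diffOpLT ħ (Nat.lt_succ_self _))

theorem series_sub_mem (ħ : ℝ) (θ lam mu : ℂ) {k : ℕ} {P : Symbol n} (hP : P.IsHomogeneous k) :
    normalOrder n ħ (series n θ lam mu P) - normalOrder n ħ P ∈ diffOpLT n k := by
  rw [series_apply hP.totalDegree_le, partialSeries, Finset.sum_range_succ', ← map_sub]
  have h0 : coeffValue n lam mu 0 = 1 := funext (coeffValue_zero n lam mu)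
  simp only [h0, LinearMap.add_apply, pow_zero, map_one, mul_one, one_smul, Module.End.one_apply,
    add_sub_cancel_right, LinearMap.sum_apply, map_sum]
  refine Submodule.sum_mem _ fun m hm => ?_
  rw [LinearMap.smul_apply, map_smul]
  refine Submodule.smul_mem _ _ (normalOrder_mem_diffOpLT ħ ?_)
  have hm' := Finset.mem_range.mp hm
  -- The index is shifted by one because the identity term m = 0 has cancelled; since m < k, this
  -- subtraction is not truncated.
  refine lt_of_le_of_lt (b := k - (m + 1)) (totalDegree_le_of_eulerFun ?_) (by omega)
  rw [Module.End.mul_apply, ← Module.End.mul_apply (eulerFun n _) (eulerFun n _), ← map_mul,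
    mul_comm, map_mul, Module.End.mul_apply]
  refine congrArg _ ?_
  have h : P = eulerFun n (fun l => if l ≤ k then 1 else 0) P := by
    rw [eulerFun_of_isHomogeneous hP, if_pos le_rfl, one_smul]
  conv_rhs => rw [h]
  rw [← Module.End.mul_apply (divergence n ^ _), divergence_pow_eulerFun, Module.End.mul_apply]
  refine congrArg (fun f => eulerFun n f _) (funext fun l => ?_)
  congr 1
  exact propext (by omega)

theorem isQuantization_series (ħ : ℝ) {lam mu : ℂ}
    (hδ : ∀ l : ℕ, mu - lam ≠ 1 + (l : ℂ) / ((n : ℂ) + 1)) :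
    IsQuantization n ħ lam mu (normalOrder n ħ ∘ₗ series n (-Complex.I * ħ) lam mu) where
  mem_diffOp P := normalOrder_mem_diffOp ħ _
  principal k P hP := series_sub_mem ħ _ _ _ hP
  equivariant X hX P := by
    obtain ⟨α, hα⟩ := exists_hasProjHessian hX
    exact hα.normalOrder_series_lieSymbol hδ ħ P

end

/-! ### Uniqueness: the Casimir identity for abstract Weyl algebra generators. -/

section

section Weyl

variable {n : ℕ} {A : Type*} [Ring A] {x d z e : Fin n → A}

theorem sum_mul_swap [Algebra ℂ A] (hdx : ∀ i j, d i * x j = x j * d i + if i = j then 1 else 0) :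
    ∑ i, d i * x i = ∑ i, x i * d i + (n : ℂ) • (1 : A) := by
  simp [hdx, Finset.sum_add_distrib, Nat.cast_smul_eq_nsmul]

theorem sum_mul_euler_mul (hdx : ∀ i j, d i * x j = x j * d i + if i = j then 1 else 0)
    (hdd : ∀ i j, d i * d j = d j * d i) :
    ∑ i, x i * (∑ j, x j * d j) * d i
      = (∑ i, x i * d i) * (∑ i, x i * d i) - ∑ i, x i * d i := by
  have h (i j : Fin n) : x i * d i * (x j * d j)
      = x i * (x j * d j) * d i + if i = j then x i * d i else 0 := by
    rw [mul_assoc, ← mul_assoc (d i), hdx, add_mul, mul_add, mul_assoc (x j), hdd i j]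
    by_cases hij : i = j
    · subst hij; simp [mul_assoc]
    · simp [hij, mul_assoc]
  simp only [Finset.sum_mul_sum, h, Finset.sum_add_distrib, Finset.sum_ite_eq, Finset.mem_univ,
    if_true, add_sub_cancel_right]
  simp only [Finset.mul_sum, Finset.sum_mul]

theorem sum_sum_mul_swap [Algebra ℂ A]
    (hdx : ∀ i j, d i * x j = x j * d i + if i = j then 1 else 0)
    (hdd : ∀ i j, d i * d j = d j * d i) :
    ∑ i, ∑ j, x i * d j * (x j * d i)
      = (∑ i, x i * d i) * (∑ i, x i * d i) + ((n : ℂ) - 1) • ∑ i, x i * d i := by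
  have h (i : Fin n) : ∑ j, x i * d j * (x j * d i)
      = x i * (∑ j, x j * d j) * d i + (n : ℂ) • (x i * d i) := by
    have h' : ∑ j, x i * d j * (x j * d i) = x i * (∑ j, d j * x j) * d i := by
      simp only [Finset.mul_sum, Finset.sum_mul, mul_assoc]
    rw [h', sum_mul_swap hdx]
    simp [mul_add, add_mul]
  simp only [h, Finset.sum_add_distrib, sum_mul_euler_mul hdx hdd, ← Finset.smul_sum]
  module

/-- Here x, d stand for xⁱ, ∂/∂xⁱ and z, e for ξᵢ, ∂/∂ξᵢ. Normally ordered, everything is expressed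
by Σxd, Σze and the product (Σxz)(Σde); the terms involving x or d cancel, leaving a polynomial in
Σze. -/
theorem weyl_casimir [Algebra ℂ A]
    (hdx : ∀ i j, d i * x j = x j * d i + if i = j then 1 else 0)
    (hez : ∀ i j, e i * z j = z j * e i + if i = j then 1 else 0)
    (hdd : ∀ i j, d i * d j = d j * d i) (hee : ∀ i j, e i * e j = e j * e i)
    (hdz : ∀ i j, d i * z j = z j * d i) (hde : ∀ i j, d i * e j = e j * d i)
    (hex : ∀ i j, e i * x j = x j * e i) (hzx : ∀ i j, z i * x j = x j * z i) (δ : ℂ) :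
    ∑ i, ∑ j, (x i * d j - z j * e i + if i = j then δ • (1 : A) else 0)
        * (x j * d i - z i * e j + if j = i then δ • (1 : A) else 0)
      + (∑ i, x i * d i - ∑ i, z i * e i + (n * δ) • (1 : A))
        * (∑ i, x i * d i - ∑ i, z i * e i + (n * δ) • (1 : A))
      - ∑ i, (d i * (x i * (∑ i, x i * d i - ∑ i, z i * e i + ((n + 1) * δ) • (1 : A))
            - (∑ j, x j * z j) * e i)
          + (x i * (∑ i, x i * d i - ∑ i, z i * e i + ((n + 1) * δ) • (1 : A))
            - (∑ j, x j * z j) * e i) * d i)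
      = (2 : ℂ) • ((∑ i, z i * e i) * ∑ i, z i * e i)
        + (2 * (n - (n + 1) * δ)) • ∑ i, z i * e i + (n * (n + 1) * (δ ^ 2 - δ)) • (1 : A) := by
  have hxx := sum_sum_mul_swap hdx hdd
  have hzz : ∑ i, ∑ j, z j * e i * (z i * e j) = (∑ i, z i * e i) * (∑ i, z i * e i)
      + ((n : ℂ) - 1) • ∑ i, z i * e i := by
    rw [Finset.sum_comm]
    exact sum_sum_mul_swap hez hee
  have hxz : ∑ i, ∑ j, x i * d j * (z i * e j) = (∑ j, x j * z j) * ∑ i, d i * e i := by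
    rw [Finset.sum_mul_sum]
    refine Finset.sum_congr rfl fun i _ => Finset.sum_congr rfl fun j _ => ?_
    rw [mul_assoc, ← mul_assoc (d j), hdz]
    simp only [mul_assoc]
  have hzx' : ∑ i, ∑ j, z j * e i * (x j * d i) = (∑ j, x j * z j) * ∑ i, d i * e i := by
    rw [Finset.sum_comm, Finset.sum_mul_sum]
    refine Finset.sum_congr rfl fun i _ => Finset.sum_congr rfl fun j _ => ?_
    rw [mul_assoc, ← mul_assoc (e j), hex, mul_assoc, ← mul_assoc, hzx, ← hde]
  have hRx := sum_mul_euler_mul hdx hdd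
  have hdxn := sum_mul_swap hdx
  have hdZ : ∑ i, d i * ((∑ j, x j * z j) * e i)
      = (∑ j, x j * z j) * (∑ i, d i * e i) + ∑ i, z i * e i := by
    have h (i : Fin n) : d i * ∑ j, x j * z j = (∑ j, x j * z j) * d i + z i := by
      simp only [Finset.mul_sum, Finset.sum_mul, ← mul_assoc, hdx, add_mul, Finset.sum_add_distrib]
      refine congrArg₂ _ (Finset.sum_congr rfl fun j _ => ?_) (by simp)
      rw [mul_assoc, hdz, mul_assoc]
    simp only [← mul_assoc, h, add_mul, Finset.sum_add_distrib, Finset.mul_sum]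
  have hZd : ∑ i, (∑ j, x j * z j) * e i * d i = (∑ j, x j * z j) * ∑ i, d i * e i := by
    simp only [hde, Finset.mul_sum, mul_assoc]
  have hEx (i : Fin n) : (∑ j, z j * e j) * x i = x i * ∑ j, z j * e j := by
    simp only [Finset.mul_sum, Finset.sum_mul, mul_assoc, hex]
    simp only [← mul_assoc, hzx]
  have hEd (i : Fin n) : (∑ j, z j * e j) * d i = d i * ∑ j, z j * e j := by
    simp only [Finset.mul_sum, Finset.sum_mul, mul_assoc, ← hde]
    simp only [← mul_assoc, ← hdz]
  have hER : (∑ j, z j * e j) * (∑ i, x i * d i) = (∑ i, x i * d i) * ∑ j, z j * e j := by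
    rw [Finset.mul_sum, Finset.sum_mul (f := fun i => x i * d i)]
    refine Finset.sum_congr rfl fun i _ => ?_
    rw [← mul_assoc, hEx, mul_assoc, hEd, mul_assoc]
  have hxEd : ∑ i, x i * (∑ j, z j * e j) * d i = (∑ i, x i * d i) * ∑ j, z j * e j := by
    rw [Finset.sum_mul (f := fun i => x i * d i)]
    refine Finset.sum_congr rfl fun i _ => ?_
    rw [mul_assoc, hEd, mul_assoc]
  have hdd' (W : A) : ∑ i, d i * (x i * W) = (∑ i, d i * x i) * W := by
    simp only [Finset.sum_mul, mul_assoc]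
  have hHH : ∑ i, ∑ j, (x i * d j - z j * e i + if i = j then δ • (1 : A) else 0)
        * (x j * d i - z i * e j + if j = i then δ • (1 : A) else 0)
      = ∑ i, ∑ j, x i * d j * (x j * d i) - ∑ i, ∑ j, x i * d j * (z i * e j)
        - ∑ i, ∑ j, z j * e i * (x j * d i) + ∑ i, ∑ j, z j * e i * (z i * e j)
        + (2 * δ) • (∑ i, x i * d i - ∑ i, z i * e i) + (n * δ ^ 2) • (1 : A) := by
    have h (i j : Fin n) : (x i * d j - z j * e i + if i = j then δ • (1 : A) else 0)
        * (x j * d i - z i * e j + if j = i then δ • (1 : A) else 0)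
        = x i * d j * (x j * d i) - x i * d j * (z i * e j) - z j * e i * (x j * d i)
          + z j * e i * (z i * e j)
          + if i = j then (2 * δ) • (x i * d i - z i * e i) + (δ ^ 2) • (1 : A) else 0 := by
      by_cases hij : i = j
      · subst hij
        simp only [if_true, mul_add, add_mul, mul_sub, sub_mul, mul_smul_comm, smul_mul_assoc,
          mul_one, one_mul]
        module
      · simp only [hij, Ne.symm hij, if_false, add_zero, mul_sub, sub_mul]
        abel
    simp only [h, Finset.sum_add_distrib, Finset.sum_sub_distrib, Finset.sum_ite_eq,
      Finset.mem_univ, if_true, ← Finset.smul_sum, Finset.sum_const, Finset.card_univ,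
      Fintype.card_fin, mul_smul, Nat.cast_smul_eq_nsmul]
    module
  rw [hHH, hxx, hzz, hxz, hzx']
  simp only [Finset.sum_add_distrib, mul_sub, sub_mul, Finset.sum_sub_distrib, hdZ, hZd]
  simp only [mul_add, add_mul, mul_sub, sub_mul, Finset.sum_add_distrib, Finset.sum_sub_distrib,
    hRx, hxEd, hdd', hdxn, hER, mul_smul_comm, smul_mul_assoc, mul_one, one_mul, ← Finset.smul_sum]
  module

end Weyl

/-! ### The Casimir operator on symbols and its eigenvalues. -/

variable {n : ℕ}

/-- The quadratic projective vector field `xᵃ xʲ ∂ⱼ`. -/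
def quadField (a : Fin n) : VField n := fun j => coord a * coord j

/-- The Casimir operator of the action `ρ` of the projective vector fields. -/
def casimir {V : Type*} [AddCommGroup V] [Module ℂ V] (ρ : VField n → Module.End ℂ V) :
    Module.End ℂ V :=
  ∑ i, ∑ j, ρ (Pi.single j (coord i)) * ρ (Pi.single i (coord j)) + ρ coord * ρ coord
    - ∑ i, (ρ (Pi.single i 1) * ρ (quadField i) + ρ (quadField i) * ρ (Pi.single i 1))

theorem single_one_mem (i : Fin n) : (Pi.single i 1 : VField n) ∈ projectiveFields n :=
  Submodule.subset_span (Or.inl (Or.inl ⟨i, rfl⟩))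

theorem single_coord_mem (i j : Fin n) : (Pi.single j (coord i) : VField n) ∈ projectiveFields n :=
  Submodule.subset_span (Or.inl (Or.inr ⟨(i, j), rfl⟩))

theorem quadField_mem (i : Fin n) : quadField i ∈ projectiveFields n :=
  Submodule.subset_span (Or.inr ⟨i, rfl⟩)

/-- Read as a vector field, `coord` is xⁱ∂ᵢ, the sum of the diagonal linear fields. -/
theorem coord_mem : (coord : VField n) ∈ projectiveFields n := by
  rw [← Finset.univ_sum_single (coord : VField n)]
  exact Submodule.sum_mem _ fun i _ => single_coord_mem i i

/-- The Casimir is one fixed quadratic expression in the action, so intertwining alone suffices: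
neither its centrality nor its form on operators is needed. -/
theorem map_casimir {V W : Type*} [AddCommGroup V] [Module ℂ V] [AddCommGroup W] [Module ℂ W]
    {ρ : VField n → Module.End ℂ V} {σ : VField n → Module.End ℂ W} {Q : V →ₗ[ℂ] W}
    (hQ : ∀ X ∈ projectiveFields n, ∀ v, Q (ρ X v) = σ X (Q v)) (v : V) :
    Q (casimir ρ v) = casimir σ (Q v) := by
  simp only [casimir, LinearMap.sub_apply, LinearMap.add_apply, LinearMap.sum_apply,
    Module.End.mul_apply, map_sub, map_add, map_sum, hQ _ (single_coord_mem _ _),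
    hQ _ (single_one_mem _), hQ _ (quadField_mem _), hQ _ coord_mem]

theorem lieSymbol_single (δ : ℂ) (j : Fin n) (a : Smooth n) (P : Symbol n) :
    lieSymbol δ (Pi.single j a) P = C a * dx j P - X j * ∑ k, C (pd k a) * dxi k P
      + δ • (C (pd j a) * P) := by
  have h1 : ∑ i, C ((Pi.single j a : VField n) i) * dx i P = C a * dx j P := by
    rw [Finset.sum_eq_single j] <;> simp +contextual
  have h2 : ∑ i, X i * ∑ k, C (pd k ((Pi.single j a : VField n) i)) * dxi k P
      = X j * ∑ k, C (pd k a) * dxi k P := by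
    rw [Finset.sum_eq_single j] <;> simp +contextual
  have h3 : VField.div (Pi.single j a) = pd j a := by
    rw [VField.div, Finset.sum_eq_single j] <;> simp +contextual
  rw [lieSymbol_apply, h1, h2, h3]

theorem lieSymbol_single_one (δ : ℂ) (j : Fin n) : lieSymbol δ (Pi.single j 1) = dx j := by
  refine LinearMap.ext fun P => ?_
  simp [lieSymbol_single, pd_one]

theorem lieSymbol_single_coord (δ : ℂ) (i j : Fin n) :
    lieSymbol δ (Pi.single j (coord i)) = mulSym (C (coord i)) * dx j - mulSym (X j) * dxi i
      + if i = j then δ • (1 : Module.End ℂ (Symbol n)) else 0 := by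
  refine LinearMap.ext fun P => ?_
  rw [lieSymbol_single, Finset.sum_eq_single i]
  · by_cases h : i = j
    · subst h; simp [pd_coord]
    · simp [pd_coord, h, Ne.symm h]
  · intro k _ hk
    simp [pd_coord, hk]
  · simp

theorem lieSymbol_coord (δ : ℂ) :
    lieSymbol δ (coord : VField n) = ∑ i, mulSym (C (coord i)) * dx i
      - ∑ i, mulSym (X i) * dxi i + (n * δ) • (1 : Module.End ℂ (Symbol n)) := by
  refine LinearMap.ext fun P => ?_
  have hdiv : VField.div (coord : VField n) = algebraMap ℂ (Smooth n) n := by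
    simp [VField.div, pd_coord]
  rw [lieSymbol_apply, hdiv, C_algebraMap_mul, smul_smul, mul_comm δ]
  simp only [pd_coord, LinearMap.add_apply, LinearMap.sub_apply, LinearMap.sum_apply,
    Module.End.mul_apply, mulSym_apply, LinearMap.smul_apply, Module.End.one_apply]
  refine congrArg₂ _ (congrArg₂ _ rfl (Finset.sum_congr rfl fun i _ => ?_)) rfl
  rw [Finset.sum_eq_single i] <;> simp +contextual

theorem lieSymbol_quadField (δ : ℂ) (a : Fin n) :
    lieSymbol δ (quadField a) = mulSym (C (coord a)) * (∑ i, mulSym (C (coord i)) * dx i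
        - ∑ i, mulSym (X i) * dxi i + ((n + 1) * δ) • (1 : Module.End ℂ (Symbol n)))
      - (∑ j, mulSym (C (coord j)) * mulSym (X j)) * dxi a := by
  refine LinearMap.ext fun P => ?_
  have hdiv : VField.div (quadField a) = (n + 1 : ℂ) • coord a := by
    simp only [VField.div, quadField, pd_mul, pd_coord, mul_ite, mul_one, mul_zero]
    simp [Finset.sum_add_distrib, add_smul, Nat.cast_smul_eq_nsmul]
  have h (i : Fin n) : X i * ∑ j, C (pd j (quadField a i)) * dxi j P
      = C (coord a) * (X i * dxi i P) + C (coord i) * (X i * dxi a P) := by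
    have h' (j : Fin n) : C (pd j (quadField a i)) * dxi j P
        = (if j = i then C (coord a) * dxi j P else 0)
          + if j = a then C (coord i) * dxi j P else 0 := by
      rw [quadField, pd_mul, pd_coord, pd_coord]
      split_ifs <;> simp [add_mul]
    simp only [h', Finset.sum_add_distrib, Finset.sum_ite_eq', Finset.mem_univ, if_true]
    ring
  have hdiv' : C (quadField a).div * P = (n + 1 : ℂ) • (C (coord a) * P) := by
    rw [hdiv, Algebra.smul_def, C_mul, mul_assoc, C_algebraMap_mul]
  have h0 : ∑ i, C (quadField a i) * dx i P = C (coord a) * ∑ i, C (coord i) * dx i P := by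
    simp only [quadField, C_mul, mul_assoc, Finset.mul_sum]
  rw [lieSymbol_apply, hdiv', h0]
  simp only [h, LinearMap.add_apply, LinearMap.sub_apply, LinearMap.sum_apply,
    Module.End.mul_apply, mulSym_apply, LinearMap.smul_apply, Module.End.one_apply, mul_add,
    mul_sub, Finset.sum_add_distrib, ← Finset.mul_sum, mul_smul_comm]
  module

/-- The eigenvalue of the Casimir operator on symbols of degree `k`. -/
def casimirValue (n : ℕ) (δ : ℂ) (k : ℕ) : ℂ :=
  2 * (k * k) + 2 * (n - (n + 1) * δ) * k + n * (n + 1) * (δ ^ 2 - δ)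

theorem casimir_lieSymbol (δ : ℂ) :
    casimir (lieSymbol (n := n) δ) = eulerFun n (casimirValue n δ) := by
  have h := weyl_casimir (n := n) (A := Module.End ℂ (Symbol n)) (x := fun i => mulSym (C (coord i)))
    (d := dx) (z := fun i => mulSym (X i)) (e := dxi) ?_ ?_ ?_ ?_ ?_ ?_ ?_ ?_ δ
  · simp only [casimir, lieSymbol_single_one, lieSymbol_single_coord, lieSymbol_coord,
      lieSymbol_quadField]
    rw [h]
    have hE : ∑ i, mulSym (X i) * dxi i = eulerFun n (fun k => (k : ℂ)) := euler_eq
    rw [hE, ← map_mul, ← map_smul, ← map_smul, ← Algebra.algebraMap_eq_smul_one,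
      ← AlgHom.commutes (eulerFun n), ← map_add, ← map_add]
    rfl
  · intro i j
    refine LinearMap.ext fun P => ?_
    simp only [Module.End.mul_apply, mulSym_apply, LinearMap.add_apply, dx_C_mul, pd_coord]
    split_ifs <;> simp [add_comm]
  · intro i j
    refine LinearMap.ext fun P => ?_
    simp only [Module.End.mul_apply, mulSym_apply, LinearMap.add_apply, dxi_X_mul]
    split_ifs <;> simp [add_comm]
  · exact fun i j => LinearMap.ext (dx_comm i j)
  · exact fun i j => LinearMap.ext (dxi_comm i j)
  · exact fun i j => LinearMap.ext (dx_X_mul i j)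
  · exact fun i j => LinearMap.ext (dx_dxi i j)
  · exact fun i j => LinearMap.ext (dxi_C_mul i _)
  · exact fun i j => LinearMap.ext fun P => mul_left_comm _ _ P

/-- With k = l + p + 1 the difference of the values factors as 2(p+1)((n+1)(1-δ) + 2l + p), whose
last factor is nonzero by the condition on δ. -/
theorem casimirValue_ne {δ : ℂ} (hδ : ∀ l : ℕ, δ ≠ 1 + (l : ℂ) / ((n : ℂ) + 1)) {k l : ℕ}
    (h : l < k) : casimirValue n δ l ≠ casimirValue n δ k := by
  intro he
  obtain ⟨p, rfl⟩ : ∃ p, k = l + p + 1 := ⟨k - l - 1, by omega⟩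
  have hp : (p : ℂ) + 1 ≠ 0 := p.cast_add_one_ne_zero
  have hw := weight_ne_zero hδ (2 * l + p)
  refine mul_ne_zero (mul_ne_zero two_ne_zero hp) hw ?_
  simp only [casimirValue] at he
  push_cast at he ⊢
  linear_combination -he

/-! ### Casimir eigenspaces of operators and the uniqueness argument. -/

/-- The Lie derivative of operators as a linear map. -/
def lieOpLinear (lam mu : ℂ) (X : VField n) : Module.End ℂ (Module.End ℂ (Smooth n)) :=
  LinearMap.mulLeft ℂ (lieDensity mu X) - LinearMap.mulRight ℂ (lieDensity lam X)

theorem IsQuantization.casimir_apply {ħ : ℝ} {lam mu : ℂ}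
    {Q : Symbol n →ₗ[ℂ] Module.End ℂ (Smooth n)} (hQ : IsQuantization n ħ lam mu Q) {k : ℕ}
    {P : Symbol n} (hP : P.IsHomogeneous k) :
    Q P ∈ (casimir (lieOpLinear (n := n) lam mu)).eigenspace (casimirValue n (mu - lam) k) := by
  rw [Module.End.mem_eigenspace_iff,
    ← map_casimir (ρ := lieSymbol (mu - lam)) (fun X hX P => hQ.equivariant X hX P),
    casimir_lieSymbol, eulerFun_of_isHomogeneous hP, map_smul]

/-- Up to the factor θ^|s|, invertible as ħ ≠ 0, the operator a∂^s is Q(aξ^s), an eigenvector, minus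
an error of order below |s|, which induction covers. -/
theorem diffOpLT_le_iSup_eigenspace {ħ : ℝ} (hħ : ħ ≠ 0) {lam mu : ℂ}
    {Q : Symbol n →ₗ[ℂ] Module.End ℂ (Smooth n)} (hQ : IsQuantization n ħ lam mu Q) (k : ℕ) :
    diffOpLT n k ≤ ⨆ l : Fin k,
      (casimir (lieOpLinear (n := n) lam mu)).eigenspace (casimirValue n (mu - lam) l) := by
  induction k using Nat.strong_induction_on with
  | _ k ih =>
  refine Submodule.span_le.mpr ?_
  rintro _ ⟨a, s, hs, rfl⟩
  have hθ : (-Complex.I * ħ : ℂ) ^ s.degree ≠ 0 :=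
    pow_ne_zero _ (mul_ne_zero (neg_ne_zero.mpr Complex.I_ne_zero) (Complex.ofReal_ne_zero.mpr hħ))
  have hm : (monomial s a : Symbol n).IsHomogeneous s.degree := isHomogeneous_monomial _ rfl
  have h1 : mulFun a * multiPd s = ((-Complex.I * ħ : ℂ) ^ s.degree)⁻¹ •
      (Q (monomial s a) - (Q (monomial s a) - normalOrder n ħ (monomial s a))) := by
    rw [sub_sub_cancel, normalOrder_monomial, inv_smul_smul₀ hθ]
  rw [h1]
  refine Submodule.smul_mem _ _ (Submodule.sub_mem _ ?_ ?_)
  · exact Submodule.mem_iSup_of_mem ⟨s.degree, hs⟩ (hQ.casimir_apply hm)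
  · refine (ih s.degree hs).trans ?_ (hQ.principal _ _ hm)
    exact iSup_le fun l => le_iSup_of_le (Fin.castLE hs.le l) le_rfl

theorem IsQuantization.unique {ħ : ℝ} (hħ : ħ ≠ 0) {lam mu : ℂ}
    (hδ : ∀ l : ℕ, mu - lam ≠ 1 + (l : ℂ) / ((n : ℂ) + 1))
    {Q Q' : Symbol n →ₗ[ℂ] Module.End ℂ (Smooth n)} (hQ : IsQuantization n ħ lam mu Q)
    (hQ' : IsQuantization n ħ lam mu Q') : Q = Q' := by
  refine Symbol.hom_ext fun s a => sub_eq_zero.mp ?_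
  have hm : (monomial s a : Symbol n).IsHomogeneous s.degree := isHomogeneous_monomial _ rfl
  have h1 := Submodule.sub_mem _ (hQ.casimir_apply hm) (hQ'.casimir_apply hm)
  have h2 : Q (monomial s a) - Q' (monomial s a) ∈ diffOpLT n s.degree := by
    have h := Submodule.sub_mem _ (hQ.principal _ _ hm) (hQ'.principal _ _ hm)
    rwa [sub_sub_sub_cancel_right] at h
  -- The difference lies in the eigenspace of its own degree and in the sum of those of lower
  -- degrees, which meet only in zero.
  refine Submodule.disjoint_def.mp ((casimir (lieOpLinear (n := n) lam mu)).eigenspaces_iSupIndep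
    (casimirValue n (mu - lam) s.degree)) _ h1 ?_
  refine (diffOpLT_le_iSup_eigenspace hħ hQ s.degree).trans (iSup_le fun l => ?_) h2
  exact le_iSup₂_of_le _ (casimirValue_ne hδ l.2) le_rfl

theorem series_eq_sum_coeffOp {lam mu : ℂ}
    (hδ : ∀ l : ℕ, mu - lam ≠ 1 + (l : ℂ) / ((n : ℂ) + 1)) (θ : ℂ) {k : ℕ} {P : Symbol n}
    (hP : P.totalDegree ≤ k) :
    series n θ lam mu P
      = ∑ m ∈ Finset.range (k + 1), coeffOp n lam mu m (((θ • divergence n) ^ m) P) := by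
  rw [series_apply hP, partialSeries, LinearMap.sum_apply]
  refine Finset.sum_congr rfl fun m _ => ?_
  rw [coeffOp_eq hδ, smul_pow, LinearMap.smul_apply, LinearMap.smul_apply, map_smul,
    Module.End.mul_apply]

end

end ProjQuant

end

theorem corollary3p2 (n : ℕ) (ħ : ℝ) (hħ : ħ ≠ 0) (lam mu : ℂ)
    (hδ : ∀ l : ℕ, mu - lam ≠ 1 + (l : ℂ) / ((n : ℂ) + 1)) :
    (∀ m : ℕ, IsUnit (ProjQuant.coeffDen n (mu - lam) m)) ∧
    (∃! Q : ProjQuant.Symbol n →ₗ[ℂ] Module.End ℂ (ProjQuant.Smooth n),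
      ProjQuant.IsQuantization n ħ lam mu Q) ∧
    (∀ Q : ProjQuant.Symbol n →ₗ[ℂ] Module.End ℂ (ProjQuant.Smooth n),
      ProjQuant.IsQuantization n ħ lam mu Q →
      ∀ (k : ℕ) (P : ProjQuant.Symbol n), P.totalDegree ≤ k →
        Q P = ProjQuant.normalOrder n ħ
          (∑ m ∈ Finset.range (k + 1),
            ProjQuant.coeffOp n lam mu m
              (((-Complex.I * (ħ : ℂ)) • ProjQuant.divergence n) ^ m <| P))) := by
  have hQ := ProjQuant.isQuantization_series ħ hδ
  refine ⟨ProjQuant.isUnit_coeffDen hδ, ⟨_, hQ, fun Q' hQ' => hQ'.unique hħ hδ hQ⟩,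
    fun Q hQ' k P hP => ?_⟩
  rw [hQ'.unique hħ hδ hQ, LinearMap.comp_apply, ProjQuant.series_eq_sum_coeffOp hδ _ hP]
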